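/- Theorem 1 (Exponential stability of the reduced closed-loop system in relative coordinates). Setting. Let $n\ge 1$ be the number of inverters. Let $S={\rm diag}(S_i)$ with $S_i>0$ (rated powers), $m={\rm diag}(m_i)$ (droop coefficients), voltage limits $V_i^{\min}<V_i^{\max}$ with $V_i^\star=\tfrac12(V_i^{\max}+V_i^{\min})$, $\Delta_i=\tfrac12(V_i^{\max}-V_i^{\min})$, $V_\star={\rm col}(V_i^\star)$, $[V_\star]={\rm diag}(V_i^\star)$, $\Delta={\rm diag}(\Delta_i)$; constants $\tau_v,\tau_d,\beta,k>0$ and $\omega_{\rm nom}\in\mathbb R$; and a linear power-flow model $P=J_\theta^P\theta+J_V^PV+w_P$, $Q=J_\theta^Q\theta+J_V^QV+w_Q$ with $J_\theta^P1_n=J_\theta^Q1_n=0$ (for example the linearization of the AC power-flow equations at an operating point). Let $\mathcal L$ be the Laplacian of a connected undirected communication graph with nonnegative weights and let $\mathcal K=(I_n+k\mathcal L)^{-1}$. Let $I_r=[0_{n-1}\ I_{n-1}]\in\mathbb R^{(n-1)\times n}$, and let $T\in\mathbb R^{n\times n}$ be the invertible matrix whose first row is $(1/n,\dots,1/n)$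 and whose $(i+1)$-st row maps $x$ to $x_{i+1}-x_i$, $1\le i\le n-1$. Put $$R_\theta=-I_rTmS^{-1}J_\theta^PT^{-1}I_r^\top,\quad R_{\theta V}=-I_rTmS^{-1}J_V^P,\quad R_{v\theta}=[V_\star](\mathcal K-I_n)S^{-1}J_\theta^QT^{-1}I_r^\top,$$ $$R_{vV}=[V_\star](\mathcal K-I_n)S^{-1}J_V^Q,\quad R_{v\zeta}=-[V_\star]\mathcal K\mathcal LT^{-1}I_r^\top,\quad R_{\zeta\theta}=\tau_v^{-1}I_rT\mathcal L\mathcal KS^{-1}J_\theta^QT^{-1}I_r^\top,$$ $$R_{\zeta V}=\tau_v^{-1}I_rT\mathcal L\mathcal KS^{-1}J_V^Q,\quad R_\zeta=-\tau_v^{-1}I_rT\mathcal L\mathcal K\mathcal LT^{-1}I_r^\top,$$ $$d_\theta=\omega_{\rm nom}I_rT1_n-I_rTmS^{-1}w_P,\quad d_v=\beta V_\star+[V_\star](\mathcal K-I_n)S^{-1}w_Q,\quad d_\zeta=\tau_v^{-1}I_rT\mathcal L\mathcal KS^{-1}w_Q.$$ With $\varepsilon=\tau_d/\tau_v$, consider,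 for $r_\theta,r_\zeta\in\mathbb R^{n-1}$ and $v\in\mathbb R^n$, the system $$\dot r_\theta=R_\theta r_\theta+R_{\theta V}V+d_\theta,$$ $$\tau_v\dot v=R_{v\theta}r_\theta+(R_{vV}-\beta I_n)V+R_{v\zeta}r_\zeta-\rho(v)v+d_v,$$ $$\varepsilon\dot r_\zeta=R_{\zeta\theta}r_\theta+R_{\zeta V}V+R_\zeta r_\zeta+d_\zeta,$$ where $V=V_\star+\Delta\tanh(\Delta^{-1}v)$ (with $\tanh$ applied componentwise) and $\rho(v)={\rm diag}(\rho_i(v_i))$, $\rho_i(v_i)=|v_i/\Delta_i|-3$ if $|v_i|>3\Delta_i$ and $\rho_i(v_i)=0$ otherwise. Statement. Let $R_{v\theta}^{\rm new}=R_{v\theta}-R_{v\zeta}R_\zeta^{-1}R_{\zeta\theta}$ and $R_{vV}^{\rm new}=R_{vV}-R_{v\zeta}R_\zeta^{-1}R_{\zeta V}$. Suppose that there are a symmetric matrix $\mathcal P_\theta\succ0$ and a diagonal matrix $\mathcal D_v\succ0$ such that $$\mathcal Q=\begin{bmatrix}\mathcal P_\theta R_\theta&\mathcal P_\theta R_{\theta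 V}\\ \mathcal D_vR_{v\theta}^{\rm new}&\mathcal D_v(R_{vV}^{\rm new}-\beta I_n)\end{bmatrix}\quad\text{satisfies}\quad\mathcal Q+\mathcal Q^\top\prec0.$$ Then the system has exactly one steady state (which does not depend on $\tau_d$), and, with all data other than $\tau_d$ fixed, there is $\varepsilon^\star>0$ such that for all $\tau_d>0$ with $\tau_d<\varepsilon^\star\tau_v$ this steady state $\bar x$ is exponentially stable: there are $c,\kappa,\mu>0$ such that for every initial value $x_0=(r_\theta,v,r_\zeta)(0)$ with $\|x_0-\bar x\|<c$ the solution $x(t)$ exists for all $t\ge0$ and satisfies $\|x(t)-\bar x\|\le\kappa\|x_0-\bar x\|e^{-\mu t}$. -/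

import Mathlib

open Matrix Set

noncomputable section

/-! ### Exponential stability of an equilibrium of an autonomous ODE -/

/-- `x` solves `x' = f x` on the time set `I` (one-sided derivative at an end point of `I`). -/
def SolvesOn {E : Type*} [NormedAddCommGroup E] [NormedSpace ℝ E]
    (f : E → E) (x : ℝ → E) (I : Set ℝ) : Prop :=
  ∀ t ∈ I, HasDerivWithinAt x (f (x t)) I t

/-- (Local) exponential stability of the equilibrium `xbar` of `x' = f x`: there are positive
constants `c, κ, μ` such that from every initial value `x₀` with `‖x₀ - xbar‖ < c` there starts
a solution defined for all times `t ≥ 0`, and every solution starting at `x₀`, on whatever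
interval `[0, τ)` it is defined, satisfies `‖x t - xbar‖ ≤ κ ‖x₀ - xbar‖ exp (-μ t)` there. -/
def ExponentiallyStable {E : Type*} [NormedAddCommGroup E] [NormedSpace ℝ E]
    (f : E → E) (xbar : E) : Prop :=
  f xbar = 0 ∧
  ∃ c > 0, ∃ κ > 0, ∃ μ > 0, ∀ x₀ : E, ‖x₀ - xbar‖ < c →
    (∃ x : ℝ → E, x 0 = x₀ ∧ SolvesOn f x (Ici 0)) ∧
    ∀ (τ : ℝ) (x : ℝ → E), x 0 = x₀ → SolvesOn f x (Ico 0 τ) →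
      ∀ t ∈ Ico 0 τ, ‖x t - xbar‖ ≤ κ * ‖x₀ - xbar‖ * Real.exp (-μ * t)

/-! ### Power flow.  There are `n = N + 1 ≥ 1` inverters. -/

/-- Active power injections of the AC power-flow equations with reduced conductance and
susceptance matrices `G`, `B`. -/
def activePower {n : ℕ} (G B : Matrix (Fin n) (Fin n) ℝ) (θ V : Fin n → ℝ) : Fin n → ℝ :=
  fun i => ∑ j, V i * V j * (G i j * Real.cos (θ i - θ j) + B i j * Real.sin (θ i - θ j))

/-- Reactive power injections of the AC power-flow equations. -/
def reactivePower {n : ℕ} (G B : Matrix (Fin n) (Fin n) ℝ) (θ V : Fin n → ℝ) : Fin n → ℝ :=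
  fun i => ∑ j, V i * V j * (G i j * Real.sin (θ i - θ j) - B i j * Real.cos (θ i - θ j))

/-- A linear power-flow model `P = JPθ θ + JPV V + wP`, `Q = JQθ θ + JQV V + wQ`, in which a
common shift of all phase angles has no effect. -/
structure LinearPowerFlow (n : ℕ) where
  JPθ : Matrix (Fin n) (Fin n) ℝ
  JPV : Matrix (Fin n) (Fin n) ℝ
  JQθ : Matrix (Fin n) (Fin n) ℝ
  JQV : Matrix (Fin n) (Fin n) ℝ
  wP : Fin n → ℝ
  wQ : Fin n → ℝ
  JPθ_one : JPθ *ᵥ 1 = 0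
  JQθ_one : JQθ *ᵥ 1 = 0

/-- The Jacobian matrix of `f` at `x`. -/
def jacobian {n : ℕ} (f : (Fin n → ℝ) → (Fin n → ℝ)) (x : Fin n → ℝ) :
    Matrix (Fin n) (Fin n) ℝ :=
  LinearMap.toMatrix' (fderiv ℝ f x).toLinearMap

theorem jacobian_one_of_shift {n : ℕ} (f : (Fin n → ℝ) → (Fin n → ℝ)) (x : Fin n → ℝ)
    (h : ∀ t : ℝ, f (x + t • 1) = f x) : jacobian f x *ᵥ 1 = 0 := by
  have h1 : jacobian f x *ᵥ 1 = fderiv ℝ f x 1 := by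
    rw [jacobian, LinearMap.toMatrix'_mulVec]; rfl
  rw [h1]
  by_cases hf : DifferentiableAt ℝ f x
  · rw [← hf.lineDeriv_eq_fderiv]
    simp [lineDeriv, h]
  · rw [fderiv_zero_of_not_differentiableAt hf]; rfl

/-- The linearization of the AC power-flow equations at the operating point `(θ₀, V₀)`. -/
def LinearPowerFlow.linearization {n : ℕ} (G B : Matrix (Fin n) (Fin n) ℝ)
    (θ₀ V₀ : Fin n → ℝ) : LinearPowerFlow n where
  JPθ := jacobian (fun θ => activePower G B θ V₀) θ₀
  JPV := jacobian (fun V => activePower G B θ₀ V) V₀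
  JQθ := jacobian (fun θ => reactivePower G B θ V₀) θ₀
  JQV := jacobian (fun V => reactivePower G B θ₀ V) V₀
  wP := activePower G B θ₀ V₀ - jacobian (fun θ => activePower G B θ V₀) θ₀ *ᵥ θ₀
    - jacobian (fun V => activePower G B θ₀ V) V₀ *ᵥ V₀
  wQ := reactivePower G B θ₀ V₀ - jacobian (fun θ => reactivePower G B θ V₀) θ₀ *ᵥ θ₀
    - jacobian (fun V => reactivePower G B θ₀ V) V₀ *ᵥ V₀
  JPθ_one := jacobian_one_of_shift _ _ fun t => by ext i; simp [activePower]
  JQθ_one := jacobian_one_of_shift _ _ fun t => by ext i; simp [reactivePower]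

/-! ### The microgrid and its controller -/

/-- The data of the closed-loop system with `N + 1` inverters, except the dual time constant
`τ_d`, which is kept as a separate argument below. -/
structure Microgrid (N : ℕ) where
  /-- linear power-flow model -/
  pf : LinearPowerFlow (N + 1)
  /-- nominal frequency -/
  ωnom : ℝ
  /-- frequency droop coefficients -/
  m : Fin (N + 1) → ℝ
  /-- rated apparent powers -/
  S : Fin (N + 1) → ℝ
  S_pos : ∀ i, 0 < S i
  /-- lower and upper voltage limits -/
  Vmin : Fin (N + 1) → ℝ
  Vmax : Fin (N + 1) → ℝ
  Vmin_lt_Vmax : ∀ i, Vmin i < Vmax i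
  /-- time constant of the integrator -/
  τv : ℝ
  τv_pos : 0 < τv
  /-- damping gain of the integrator -/
  β : ℝ
  β_pos : 0 < β
  /-- consensus gain of the optimizer -/
  k : ℝ
  k_pos : 0 < k
  /-- weighted adjacency matrix of the undirected, connected communication graph -/
  a : Matrix (Fin (N + 1)) (Fin (N + 1)) ℝ
  a_symm : a.IsSymm
  a_nonneg : ∀ i j, 0 ≤ a i j
  a_connected : (SimpleGraph.fromRel fun i j => 0 < a i j).Connected

/-- The matrix `[0 I]` which removes the first coordinate. -/
def Ir (N : ℕ) : Matrix (Fin N) (Fin (N + 1)) ℝ :=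
  Matrix.of fun i j => if j = i.succ then 1 else 0

/-- The coordinate change `T`: the first row takes the average, the other rows take the
differences of consecutive coordinates. -/
def Tmat (N : ℕ) : Matrix (Fin (N + 1)) (Fin (N + 1)) ℝ :=
  Matrix.of fun i j =>
    Fin.cases (1 / ((N : ℝ) + 1))
      (fun i' : Fin N => if j = i'.succ then 1 else if j = i'.castSucc then -1 else 0) i

namespace Microgrid

variable {N : ℕ} (M : Microgrid N)

/-- Midpoint `V⋆` of the voltage limits. -/
def Vstar : Fin (N + 1) → ℝ := fun i => (M.Vmax i + M.Vmin i) / 2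

/-- Maximal deviation `Δ` from the midpoint. -/
def Δ : Fin (N + 1) → ℝ := fun i => (M.Vmax i - M.Vmin i) / 2

/-- Laplacian matrix of the communication graph. -/
def lap : Matrix (Fin (N + 1)) (Fin (N + 1)) ℝ :=
  Matrix.diagonal (fun i => ∑ j, M.a i j) - M.a

/-- `K = (I + k L)⁻¹`. -/
def K : Matrix (Fin (N + 1)) (Fin (N + 1)) ℝ := (1 + M.k • M.lap)⁻¹

/-- `S⁻¹`. -/
def Sinv : Matrix (Fin (N + 1)) (Fin (N + 1)) ℝ := (Matrix.diagonal M.S)⁻¹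

/-- `m S⁻¹`. -/
def mSinv : Matrix (Fin (N + 1)) (Fin (N + 1)) ℝ := Matrix.diagonal M.m * M.Sinv

/-! Components of the system in relative coordinates. -/

def Rθ : Matrix (Fin N) (Fin N) ℝ :=
  -(Ir N * Tmat N * M.mSinv * M.pf.JPθ * (Tmat N)⁻¹ * (Ir N)ᵀ)

def RθV : Matrix (Fin N) (Fin (N + 1)) ℝ :=
  -(Ir N * Tmat N * M.mSinv * M.pf.JPV)

def Rvθ : Matrix (Fin (N + 1)) (Fin N) ℝ :=
  Matrix.diagonal M.Vstar * (M.K - 1) * M.Sinv * M.pf.JQθ * (Tmat N)⁻¹ * (Ir N)ᵀ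

def RvV : Matrix (Fin (N + 1)) (Fin (N + 1)) ℝ :=
  Matrix.diagonal M.Vstar * (M.K - 1) * M.Sinv * M.pf.JQV

def Rvζ : Matrix (Fin (N + 1)) (Fin N) ℝ :=
  -(Matrix.diagonal M.Vstar * M.K * M.lap * (Tmat N)⁻¹ * (Ir N)ᵀ)

def Rζθ : Matrix (Fin N) (Fin N) ℝ :=
  M.τv⁻¹ • (Ir N * Tmat N * M.lap * M.K * M.Sinv * M.pf.JQθ * (Tmat N)⁻¹ * (Ir N)ᵀ)

def RζV : Matrix (Fin N) (Fin (N + 1)) ℝ :=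
  M.τv⁻¹ • (Ir N * Tmat N * M.lap * M.K * M.Sinv * M.pf.JQV)

def Rζ : Matrix (Fin N) (Fin N) ℝ :=
  -(M.τv⁻¹ • (Ir N * Tmat N * M.lap * M.K * M.lap * (Tmat N)⁻¹ * (Ir N)ᵀ))

def dθ : Fin N → ℝ :=
  M.ωnom • ((Ir N * Tmat N) *ᵥ 1) - (Ir N * Tmat N * M.mSinv) *ᵥ M.pf.wP

def dv : Fin (N + 1) → ℝ :=
  M.β • M.Vstar + (Matrix.diagonal M.Vstar * (M.K - 1) * M.Sinv) *ᵥ M.pf.wQ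

def dζ : Fin N → ℝ :=
  M.τv⁻¹ • ((Ir N * Tmat N * M.lap * M.K * M.Sinv) *ᵥ M.pf.wQ)

/-- The voltages `V = V⋆ + Δ tanh (Δ⁻¹ v)`. -/
def volt (v : Fin (N + 1) → ℝ) : Fin (N + 1) → ℝ :=
  fun i => M.Vstar i + M.Δ i * Real.tanh (v i / M.Δ i)

/-- The leakage coefficients `ρ_i (v_i)`. -/
def ρ (v : Fin (N + 1) → ℝ) : Fin (N + 1) → ℝ :=
  fun i => if 3 * M.Δ i < |v i| then |v i / M.Δ i| - 3 else 0

/-- State space: triples `(r_θ, v, r_ζ)`. -/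
abbrev State (N : ℕ) : Type := (Fin N → ℝ) × (Fin (N + 1) → ℝ) × (Fin N → ℝ)

/-- Right-hand side of the equation for `r_θ'`. -/
def rhsθ (x : State N) : Fin N → ℝ :=
  M.Rθ *ᵥ x.1 + M.RθV *ᵥ M.volt x.2.1 + M.dθ

/-- Right-hand side of the equation for `τ_v v'`. -/
def rhsv (x : State N) : Fin (N + 1) → ℝ :=
  M.Rvθ *ᵥ x.1 + (M.RvV - M.β • 1) *ᵥ M.volt x.2.1 + M.Rvζ *ᵥ x.2.2
    - M.ρ x.2.1 * x.2.1 + M.dv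

/-- Right-hand side of the equation for `ε r_ζ'`. -/
def rhsζ (x : State N) : Fin N → ℝ :=
  M.Rζθ *ᵥ x.1 + M.RζV *ᵥ M.volt x.2.1 + M.Rζ *ᵥ x.2.2 + M.dζ

/-- Vector field of the closed-loop system in relative coordinates, with `ε = τ_d / τ_v`. -/
def field (τd : ℝ) (x : State N) : State N :=
  (M.rhsθ x, M.τv⁻¹ • M.rhsv x, (τd / M.τv)⁻¹ • M.rhsζ x)

/-- Steady states of the system in relative coordinates; they do not depend on `τ_d`. -/
def IsSteadyState (x : State N) : Prop :=
  M.rhsθ x = 0 ∧ M.rhsv x = 0 ∧ M.rhsζ x = 0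

/-! The linear matrix inequality. -/

def RvθNew : Matrix (Fin (N + 1)) (Fin N) ℝ := M.Rvθ - M.Rvζ * M.Rζ⁻¹ * M.Rζθ

def RvVNew : Matrix (Fin (N + 1)) (Fin (N + 1)) ℝ := M.RvV - M.Rvζ * M.Rζ⁻¹ * M.RζV

def Qmat (Pθ : Matrix (Fin N) (Fin N) ℝ) (Dv : Matrix (Fin (N + 1)) (Fin (N + 1)) ℝ) :
    Matrix (Fin N ⊕ Fin (N + 1)) (Fin N ⊕ Fin (N + 1)) ℝ :=
  Matrix.fromBlocks (Pθ * M.Rθ) (Pθ * M.RθV) (Dv * M.RvθNew) (Dv * (M.RvVNew - M.β • 1))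

/-- The linear matrix inequality `Pθ ≻ 0`, `Dv ≻ 0`, `Q + Qᵀ ≺ 0` (`Pθ` symmetric, `Dv`
diagonal) has a solution. -/
def LMIFeasible : Prop :=
  ∃ (Pθ : Matrix (Fin N) (Fin N) ℝ) (Dv : Matrix (Fin (N + 1)) (Fin (N + 1)) ℝ),
    Pθ.PosDef ∧ Dv.IsDiag ∧ Dv.PosDef ∧ (-(M.Qmat Pθ Dv + (M.Qmat Pθ Dv)ᵀ)).PosDef

end Microgrid

end

/-! The linear matrix inequality makes `lmiForm` negative definite. Its arguments are an error `a`
in `r_θ` and an error `b` in the voltages `V`, with `r_ζ` eliminated through the invertible matrix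
`Rζ`. This is combined with monotonicity: each voltage is strictly increasing in `v_i`, each leakage
term `ρ_i(v_i) v_i` is nondecreasing, and diagonal positive weights preserve signs. The leakage
therefore always contributes with the favourable sign.

Steady state. Eliminating `r_ζ` and `r_θ` leaves `A V(v) + const = ρ(v) v`, where `diag(d) A` has
negative definite symmetric part. A forward-backward fixed point iteration solves it
(`exists_mulVec_add_eq`). For two steady states the form at their difference equals a nonnegative
leakage sum, so the difference vanishes (`isSteadyState_unique`).

Stability. Let `e` be the error in `(r_θ, v)` and `z` the deviation of the `r_ζ` error from its
linearized quasi-steady value. With `α_i` the slope of the saturation at the steady state, the slow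
Lyapunov function is `e_θᵀ Pθ e_θ + ∑ τ_v d_i α_i e_{v,i}²`. For `z = 0`, half its derivative is
`lmiForm` at `(e_θ, α e_v)`, minus a nonnegative leakage sum, plus `o(‖e‖²)`. The fast part decays
because `Rζ` acts as `-τ_v⁻¹ L K L` on vectors of zero mean, where a connected graph makes it
negative definite. For small `ε` the fast decay, of order `1/ε`, dominates all cross terms
(`exists_exponentiallyStable_of_singular_perturbation`), and the sum of the two quadratic functions
proves exponential stability (`exponentiallyStable_of_quadratic_lyapunov`). -/

noncomputable section

/-! ### Quadratic Lyapunov functions -/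

section Lyapunov

variable {E : Type*} [NormedAddCommGroup E] [NormedSpace ℝ E]

/-- Radial retraction onto the closed ball of radius `r` around `a`. -/
def radialRetraction (a : E) (r : ℝ) (x : E) : E := a + (r / max r ‖x - a‖) • (x - a)

theorem radialRetraction_of_mem {a : E} {r : ℝ} (hr : 0 < r) {x : E} (hx : ‖x - a‖ ≤ r) :
    radialRetraction a r x = x := by
  rw [radialRetraction, max_eq_left hx, div_self hr.ne']
  simp

theorem norm_radialRetraction_sub_le (a : E) {r : ℝ} (hr : 0 < r) (x : E) :
    ‖radialRetraction a r x - a‖ ≤ r := by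
  have hm : 0 < max r ‖x - a‖ := lt_max_of_lt_left hr
  rw [radialRetraction, add_sub_cancel_left, norm_smul, Real.norm_of_nonneg (by positivity),
    div_mul_eq_mul_div, div_le_iff₀ hm]
  gcongr
  exact le_max_right _ _

/-- The difference splits into a rescaled `x - y` and a change of the scaling factor, each of norm
at most `‖x - y‖`. The norm need not come from an inner product, hence the constant 2. -/
theorem lipschitzWith_radialRetraction (a : E) {r : ℝ} (hr : 0 < r) :
    LipschitzWith 2 (radialRetraction a r) := by
  refine LipschitzWith.of_dist_le_mul fun x y => ?_
  set p := x - a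
  set q := y - a
  have hp : 0 < max r ‖p‖ := lt_max_of_lt_left hr
  have hq : 0 < max r ‖q‖ := lt_max_of_lt_left hr
  have key : radialRetraction a r x - radialRetraction a r y
      = (r / max r ‖p‖) • (p - q) + (r / max r ‖p‖ - r / max r ‖q‖) • q := by
    simp only [radialRetraction, p, q]
    module
  have h1 : ‖(r / max r ‖p‖) • (p - q)‖ ≤ ‖p - q‖ := by
    rw [norm_smul, Real.norm_of_nonneg (by positivity)]
    exact mul_le_of_le_one_left (norm_nonneg _) ((div_le_one hp).2 (le_max_left _ _))
  have h2 : ‖(r / max r ‖p‖ - r / max r ‖q‖) • q‖ ≤ ‖p - q‖ := by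
    have e : r / max r ‖p‖ - r / max r ‖q‖
        = (r / max r ‖p‖) * ((max r ‖q‖ - max r ‖p‖) / max r ‖q‖) := by
      field_simp
    rw [norm_smul, e, norm_mul, norm_div _ (max r ‖q‖), Real.norm_of_nonneg hq.le,
      Real.norm_of_nonneg (by positivity : 0 ≤ r / max r ‖p‖)]
    have h3 : ‖max r ‖q‖ - max r ‖p‖‖ ≤ ‖p - q‖ := by
      rw [Real.norm_eq_abs]
      rw [max_comm r, max_comm r, abs_sub_comm]
      exact (abs_max_sub_max_le_abs _ _ _).trans (abs_norm_sub_norm_le p q)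
    have h4 : r / max r ‖p‖ ≤ 1 := (div_le_one hp).2 (le_max_left _ _)
    calc r / max r ‖p‖ * (‖max r ‖q‖ - max r ‖p‖‖ / max r ‖q‖) * ‖q‖
        ≤ 1 * (‖p - q‖ / max r ‖q‖) * max r ‖q‖ := by
          gcongr
          exact le_max_right _ _
      _ = ‖p - q‖ := by field_simp
  rw [dist_eq_norm, dist_eq_norm, key]
  calc _ ≤ ‖p - q‖ + ‖p - q‖ := (norm_add_le _ _).trans (add_le_add h1 h2)
    _ = 2 * ‖x - y‖ := by simp only [p, q, sub_sub_sub_cancel_right]; ring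

/-- A bounded, globally Lipschitz vector field has solutions for all positive times. -/
theorem exists_solvesOn_Ici [CompleteSpace E] {g : E → E} {K : NNReal} (hg : LipschitzWith K g)
    {L : ℝ} (hL : ∀ x, ‖g x‖ ≤ L) (x₀ : E) : ∃ x : ℝ → E, x 0 = x₀ ∧ SolvesOn g x (Ici 0) := by
  have hL0 : 0 ≤ L := (norm_nonneg _).trans (hL x₀)
  have hex : ∀ n : ℕ, ∃ y : ℝ → E, y 0 = x₀ ∧
      ∀ t ∈ Icc (0 : ℝ) n, HasDerivWithinAt y (g (y t)) (Icc 0 n) t := by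
    intro n
    -- A field bounded by `L` moves a point by at most `L * n` in time `n`, so a ball of that radius
    -- suffices on all of `[0, n]`.
    have hP : IsPicardLindelof (fun _ : ℝ => g) (tmin := 0) (tmax := n)
        ⟨0, by simp⟩ x₀ (L.toNNReal * n) 0 L.toNNReal K := by
      refine IsPicardLindelof.of_time_independent ?_ hg.lipschitzOnWith ?_
      · intro x _
        rw [Real.coe_toNNReal _ hL0]
        exact hL x
      · simp
    exact hP.exists_eq_forall_mem_Icc_hasDerivWithinAt₀
  choose y hy0 hy using hex
  have huniq : ∀ n m : ℕ, n ≤ m → ∀ t ∈ Icc (0 : ℝ) n, y n t = y m t := by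
    intro n m hnm t ht
    have hsub : Icc (0 : ℝ) n ⊆ Icc 0 m := Icc_subset_Icc_right (by exact_mod_cast hnm)
    refine ODE_solution_unique (v := fun _ => g) (K := K) (fun _ => hg)
      (fun s hs => (hy n s hs).continuousWithinAt)
      (fun s hs => ?_)
      (fun s hs => ((hy m s (hsub hs)).mono hsub).continuousWithinAt)
      (fun s hs => ?_) ((hy0 n).trans (hy0 m).symm) ht
    · exact (hy n s (Ico_subset_Icc_self hs)).mono_of_mem_nhdsWithin
        (Icc_mem_nhdsGE_of_mem hs)
    · exact ((hy m s (hsub (Ico_subset_Icc_self hs))).mono hsub).mono_of_mem_nhdsWithin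
        (Icc_mem_nhdsGE_of_mem hs)
  have hlt : ∀ t : ℝ, t < ((⌊t⌋₊ + 1 : ℕ) : ℝ) := fun t => by
    push_cast
    exact Nat.lt_floor_add_one t
  have hx : ∀ n : ℕ, ∀ t ∈ Ico (0 : ℝ) n, y (⌊t⌋₊ + 1) t = y n t := fun n t ht =>
    huniq _ _ (Nat.succ_le_of_lt ((Nat.floor_lt ht.1).2 ht.2)) t ⟨ht.1, (hlt t).le⟩
  refine ⟨fun t => y (⌊t⌋₊ + 1) t, by simp [hy0], fun t ht => ?_⟩
  -- The added 1 puts `t` strictly below `n`, so `[0, n)` is a neighbourhood of `t` within `[0, ∞)`.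
  set n := ⌊t⌋₊ + 1 with hn
  have htn : t ∈ Ico (0 : ℝ) n := ⟨ht, hlt t⟩
  have h1 : HasDerivWithinAt (y n) (g (y n t)) (Ico 0 n) t :=
    (hy n t (Ico_subset_Icc_self htn)).mono Ico_subset_Icc_self
  have h2 : HasDerivWithinAt (fun t => y (⌊t⌋₊ + 1) t) (g (y n t)) (Ico 0 n) t :=
    h1.congr (fun s hs => hx n s hs) (hx n t htn)
  refine h2.mono_of_mem_nhdsWithin ?_
  rw [← Ici_inter_Iio]
  exact Filter.inter_mem self_mem_nhdsWithin (mem_nhdsWithin_of_mem_nhds (Iio_mem_nhds htn.2))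

/-- Decay of a quadratic Lyapunov function along solutions. -/
theorem lyapunov_le_of_solvesOn {f : E → E} {xbar : E} {W : E →L[ℝ] E →L[ℝ] ℝ}
    (hsymm : ∀ x y, W x y = W y x) {c μ r : ℝ} (hr : 0 < r) (hc : 0 < c) (hμ : 0 < μ)
    (hcoer : ∀ x, c * ‖x‖ ^ 2 ≤ W x x)
    (hdecay : ∀ x, ‖x - xbar‖ ≤ r → W (x - xbar) (f x) ≤ -μ * W (x - xbar) (x - xbar))
    {τ : ℝ} {x : ℝ → E} (h0 : W (x 0 - xbar) (x 0 - xbar) < c * r ^ 2)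
    (hx : SolvesOn f x (Ico 0 τ)) {t : ℝ} (ht : t ∈ Ico 0 τ) :
    W (x t - xbar) (x t - xbar) ≤ W (x 0 - xbar) (x 0 - xbar) * Real.exp (-μ * t) := by
  have hnn : ∀ x, 0 ≤ W x x := fun x => (by positivity : 0 ≤ c * ‖x‖ ^ 2).trans (hcoer x)
  have hder : ∀ s ∈ Ico 0 τ, HasDerivWithinAt (fun s => W (x s - xbar) (x s - xbar))
      (2 * W (x s - xbar) (f (x s))) (Ico 0 τ) s := by
    intro s hs
    have h1 := (hx s hs).sub_const xbar
    have h2 := (W.hasFDerivAt.comp_hasDerivWithinAt s h1).clm_apply h1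
    refine h2.congr_deriv ?_
    rw [hsymm (f (x s)), Function.comp_apply, two_mul]
  -- A barrier started at `b` above the initial value is positive even if the solution starts at
  -- `xbar`; letting `b` decrease to the initial value finishes the proof.
  have main : ∀ b, W (x 0 - xbar) (x 0 - xbar) < b → b < c * r ^ 2 →
      W (x t - xbar) (x t - xbar) ≤ b * Real.exp (-μ * t) := by
    intro b hb0 hb1
    have hb : 0 < b := (hnn _).trans_lt hb0
    have hsub : Icc 0 t ⊆ Ico 0 τ := fun s hs => ⟨hs.1, hs.2.trans_lt ht.2⟩
    refine image_le_of_deriv_right_lt_deriv_boundary (a := 0) (b := t)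
      (f := fun s => W (x s - xbar) (x s - xbar))
      (f' := fun s => 2 * W (x s - xbar) (f (x s)))
      (B := fun s => b * Real.exp (-μ * s)) (B' := fun s => b * (Real.exp (-μ * s) * -μ))
      (fun s hs => ((hder s (hsub hs)).mono hsub).continuousWithinAt)
      (fun s hs => (hder s (hsub (Ico_subset_Icc_self hs))).mono_of_mem_nhdsWithin ?_)
      (by simpa using hb0.le) (fun s => ?_) (fun s hs heq => ?_) ⟨ht.1, le_rfl⟩
    · exact Ico_mem_nhdsGE_of_mem (hsub (Ico_subset_Icc_self hs))
    · have h1 : HasDerivAt (fun s => -μ * s) (-μ) s := by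
        simpa using (hasDerivAt_id s).const_mul (-μ)
      exact (h1.exp).const_mul b
    · have hexp : Real.exp (-μ * s) ≤ 1 := by
        rw [Real.exp_le_one_iff]
        nlinarith [hs.1]
      have hpos := Real.exp_pos (-μ * s)
      have hlt : W (x s - xbar) (x s - xbar) < c * r ^ 2 := by
        rw [heq]
        nlinarith
      have hle : ‖x s - xbar‖ ≤ r := by
        have h1 : ‖x s - xbar‖ ^ 2 < r ^ 2 := lt_of_mul_lt_mul_left ((hcoer _).trans_lt hlt) hc.le
        exact (lt_of_pow_lt_pow_left₀ 2 hr.le h1).le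
      -- The derivative of `W` is at most `-2 * μ * W`, while only the rate `μ` is claimed. The gap
      -- gives the strict inequality needed where the solution touches the barrier.
      have h1 := hdecay _ hle
      rw [heq] at h1
      have : 0 < μ * (b * Real.exp (-μ * s)) := by positivity
      nlinarith
  have hev : ∀ᶠ b in nhdsWithin (W (x 0 - xbar) (x 0 - xbar)) (Ioi (W (x 0 - xbar) (x 0 - xbar))),
      W (x t - xbar) (x t - xbar) ≤ b * Real.exp (-μ * t) := by
    filter_upwards [Ioo_mem_nhdsGT h0] with b hb using main b hb.1 hb.2
  refine ge_of_tendsto ?_ hev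
  exact ((continuous_id.mul continuous_const).tendsto _).mono_left nhdsWithin_le_nhds

/-- A quadratic function that decays along a vector field near an equilibrium, at a rate
proportional to itself, proves that the equilibrium is exponentially stable. -/
theorem exponentiallyStable_of_quadratic_lyapunov [CompleteSpace E] {f : E → E} {xbar : E}
    (hf0 : f xbar = 0) {K : NNReal} {c μ r : ℝ} (hr : 0 < r) (hc : 0 < c) (hμ : 0 < μ)
    (hlip : LipschitzOnWith K f (Metric.closedBall xbar r)) {W : E →L[ℝ] E →L[ℝ] ℝ}
    (hsymm : ∀ x y, W x y = W y x) (hcoer : ∀ x, c * ‖x‖ ^ 2 ≤ W x x)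
    (hdecay : ∀ x, ‖x - xbar‖ ≤ r → W (x - xbar) (f x) ≤ -μ * W (x - xbar) (x - xbar)) :
    ExponentiallyStable f xbar := by
  have hnn : ∀ x, 0 ≤ W x x := fun x => (by positivity : 0 ≤ c * ‖x‖ ^ 2).trans (hcoer x)
  set C : ℝ := ‖W‖ + 1 with hC
  have hCpos : 0 < C := by positivity
  have hup : ∀ x, W x x ≤ C * ‖x‖ ^ 2 := fun x => by
    have := (le_abs_self _).trans (W.le_opNorm₂ x x)
    nlinarith [sq_nonneg ‖x‖]
  have hsmall : ∀ x₀, ‖x₀ - xbar‖ < Real.sqrt (c / C) * r →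
      W (x₀ - xbar) (x₀ - xbar) < c * r ^ 2 := by
    intro x₀ hx₀
    have h1 : ‖x₀ - xbar‖ ^ 2 < (Real.sqrt (c / C) * r) ^ 2 :=
      pow_lt_pow_left₀ hx₀ (norm_nonneg _) two_ne_zero
    rw [mul_pow, Real.sq_sqrt (by positivity)] at h1
    calc _ ≤ C * ‖x₀ - xbar‖ ^ 2 := hup _
      _ < C * (c / C * r ^ 2) := by gcongr
      _ = c * r ^ 2 := by field_simp
  have hball : ∀ x, W (x - xbar) (x - xbar) < c * r ^ 2 → ‖x - xbar‖ ≤ r := by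
    intro x hx
    have h1 : ‖x - xbar‖ ^ 2 < r ^ 2 := lt_of_mul_lt_mul_left ((hcoer _).trans_lt hx) hc.le
    exact (lt_of_pow_lt_pow_left₀ 2 hr.le h1).le
  refine ⟨hf0, Real.sqrt (c / C) * r, by positivity, Real.sqrt (C / c), by positivity, μ / 2,
    by positivity, fun x₀ hx₀ => ⟨?_, ?_⟩⟩
  -- Existence: `g` is bounded and globally Lipschitz, and its solution stays in the sublevel set of
  -- `W` inside the ball, where `g = f`.
  · set g : E → E := f ∘ radialRetraction xbar r with hg
    have hgf : ∀ x, ‖x - xbar‖ ≤ r → g x = f x := fun x hx => by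
      rw [hg, Function.comp, radialRetraction_of_mem hr hx]
    have hmem : ∀ x, radialRetraction xbar r x ∈ Metric.closedBall xbar r := fun x => by
      rw [mem_closedBall_iff_norm]
      exact norm_radialRetraction_sub_le xbar hr x
    have hglip : LipschitzWith (K * 2) g := by
      rw [← lipschitzOnWith_univ]
      exact hlip.comp (lipschitzWith_radialRetraction xbar hr).lipschitzOnWith
        (fun x _ => hmem x)
    have hgL : ∀ x, ‖g x‖ ≤ K * r := by
      intro x
      have h1 := hlip.dist_le_mul _ (hmem x) _ (Metric.mem_closedBall_self hr.le)
      rw [hf0, dist_zero_right] at h1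
      exact h1.trans (mul_le_mul_of_nonneg_left (hmem x) K.2)
    obtain ⟨x, hx0, hx⟩ := exists_solvesOn_Ici hglip hgL x₀
    have h0 := hsmall x₀ hx₀
    rw [← hx0] at h0
    refine ⟨x, hx0, fun t ht => ?_⟩
    have h1 := lyapunov_le_of_solvesOn (f := g) hsymm hr hc hμ hcoer
      (fun x hx => by rw [hgf x hx]; exact hdecay x hx) (τ := t + 1) h0
      (fun s hs => (hx s hs.1).mono Ico_subset_Ici_self) ⟨ht, lt_add_one t⟩
    have h2 : Real.exp (-μ * t) ≤ 1 := by
      rw [Real.exp_le_one_iff]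
      nlinarith [mem_Ici.1 ht]
    rw [← hgf (x t) (hball _ ?_)]
    · exact hx t ht
    · exact (h1.trans (mul_le_of_le_one_right (hnn _) h2)).trans_lt h0
  · rintro τ x rfl hx t ht
    have h1 := (hcoer _).trans (lyapunov_le_of_solvesOn hsymm hr hc hμ hcoer hdecay
      (hsmall _ hx₀) hx ht)
    have h2 : ‖x t - xbar‖ ^ 2
        ≤ (Real.sqrt (C / c) * ‖x 0 - xbar‖ * Real.exp (-(μ / 2) * t)) ^ 2 := by
      have hexp : Real.exp (-(μ / 2) * t) ^ 2 = Real.exp (-μ * t) := by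
        rw [← Real.exp_nat_mul]
        congr 1
        push_cast
        ring
      rw [mul_pow, mul_pow, Real.sq_sqrt (by positivity), hexp]
      refine le_of_mul_le_mul_left (h1.trans ?_) hc
      calc _ ≤ C * ‖x 0 - xbar‖ ^ 2 * Real.exp (-μ * t) := by
            gcongr
            exact hup _
        _ = _ := by field_simp
    exact le_of_sq_le_sq h2 (by positivity)

end Lyapunov

/-! ### Singular perturbation of an exponentially stable reduced system -/

section SingularPerturbation

variable {X Z : Type*} [NormedAddCommGroup X] [NormedSpace ℝ X] [NormedAddCommGroup Z]
  [NormedSpace ℝ Z]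

/-- Balance of the cross terms between the slow variable (of size `p`) and the fast one (of size
`q`). -/
theorem slow_fast_decay {a γ ε k m p q A₁ A₂ A₃ A₄ A₅ A₆ M₁ M₂ M₃ : ℝ} (ha : 0 < a) (hε : 0 < ε)
    (hγε : k + m ^ 2 / (2 * a) + a / 2 ≤ γ / ε) (h₁ : A₁ ≤ -a * p ^ 2) (h₂ : A₂ ≤ -γ * q ^ 2)
    (h₃ : A₃ ≤ M₁ * (p * q)) (h₄ : A₄ ≤ ε * (M₂ * (p * q))) (h₅ : -A₅ ≤ M₃ * (p * q))
    (h₆ : -A₆ ≤ k * q ^ 2) (hm : m = M₁ + M₃ + M₂) :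
    A₁ + A₃ + (ε⁻¹ * (A₂ + A₄) - (A₅ + A₆)) ≤ -(a / 2 * (p ^ 2 + q ^ 2)) := by
  have b5 : ε⁻¹ * (A₂ + A₄) ≤ -(γ / ε) * q ^ 2 + M₂ * (p * q) := by
    calc _ ≤ ε⁻¹ * (-γ * q ^ 2 + ε * (M₂ * (p * q))) := by gcongr
      _ = _ := by field_simp
  -- Young's inequality, weighted so that the slow variable pays only half of its decay `a`.
  have b6 : m * (p * q) ≤ a / 2 * p ^ 2 + m ^ 2 / (2 * a) * q ^ 2 := by
    have h : a / 2 * p ^ 2 + m ^ 2 / (2 * a) * q ^ 2 - m * (p * q)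
        = (a * p - m * q) ^ 2 / (2 * a) := by
      field_simp
      ring
    have h' : 0 ≤ (a * p - m * q) ^ 2 / (2 * a) := by positivity
    linarith
  have b7 : (k + m ^ 2 / (2 * a) + a / 2) * q ^ 2 ≤ γ / ε * q ^ 2 := by gcongr
  have b8 : m * (p * q) = M₁ * (p * q) + M₃ * (p * q) + M₂ * (p * q) := by rw [hm]; ring
  linarith

theorem abs_apply_apply_le {U V : Type*} [NormedAddCommGroup U] [NormedSpace ℝ U]
    [NormedAddCommGroup V] [NormedSpace ℝ V] (b : U →L[ℝ] V →L[ℝ] ℝ) (u : U) {w : V} {c : ℝ}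
    (hw : ‖w‖ ≤ c) : |b u w| ≤ ‖b‖ * ‖u‖ * c :=
  (b.le_opNorm₂ u w).trans (mul_le_mul_of_nonneg_left hw (by positivity))

/-- Decay of the sum of the two Lyapunov functions; `u` and `w` are the values of the reduced slow
field and of the fast perturbation. -/
theorem slow_fast_bilinear_decay {B : Z →L[ℝ] X} {H : X →L[ℝ] Z} {R : Z →L[ℝ] Z}
    {P : X →L[ℝ] X →L[ℝ] ℝ} {Q : Z →L[ℝ] Z →L[ℝ] ℝ} {a γ C ε : ℝ} (ha : 0 < a) (hε : 0 < ε)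
    (hγε : ‖Q‖ * ‖H‖ * ‖B‖ + (‖P‖ * ‖B‖ + ‖Q‖ * ‖H‖ * C + ‖Q‖) ^ 2 / (2 * a) + a / 2 ≤ γ / ε)
    {e u : X} {z w : Z} (hu : P e u ≤ -a * ‖e‖ ^ 2) (hu' : ‖u‖ ≤ C * ‖e‖) (hw : ‖w‖ ≤ ε * ‖e‖)
    (hR : Q z (R z) ≤ -γ * ‖z‖ ^ 2) :
    P e (u + B z) + Q z (ε⁻¹ • (R z + w) - H (u + B z))
      ≤ -(a / 2 / (‖P‖ + ‖Q‖ + 1)) * (P e e + Q z z) := by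
  have b1 : P e (B z) ≤ ‖P‖ * ‖B‖ * (‖e‖ * ‖z‖) :=
    ((le_abs_self _).trans (abs_apply_apply_le P e (B.le_opNorm z))).trans_eq (by ring)
  have b2 : Q z w ≤ ε * (‖Q‖ * (‖e‖ * ‖z‖)) :=
    ((le_abs_self _).trans (abs_apply_apply_le Q z hw)).trans_eq (by ring)
  have b3 : -(Q z (H u)) ≤ ‖Q‖ * ‖H‖ * C * (‖e‖ * ‖z‖) :=
    ((neg_le_abs _).trans (abs_apply_apply_le Q z
      ((H.le_opNorm u).trans (mul_le_mul_of_nonneg_left hu' (norm_nonneg _))))).trans_eq (by ring)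
  have b4 : -(Q z (H (B z))) ≤ ‖Q‖ * ‖H‖ * ‖B‖ * ‖z‖ ^ 2 :=
    ((neg_le_abs _).trans (abs_apply_apply_le Q z
      ((H.le_opNorm _).trans (mul_le_mul_of_nonneg_left (B.le_opNorm z)
        (norm_nonneg _))))).trans_eq (by ring)
  have b5 := slow_fast_decay ha hε hγε hu hR b1 b2 b3 b4 rfl
  have b6 : P e e + Q z z ≤ (‖P‖ + ‖Q‖ + 1) * (‖e‖ ^ 2 + ‖z‖ ^ 2) := by
    have h5 := (le_abs_self _).trans (P.le_opNorm₂ e e)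
    have h6 := (le_abs_self _).trans (Q.le_opNorm₂ z z)
    nlinarith [mul_nonneg (norm_nonneg P) (sq_nonneg ‖z‖),
      mul_nonneg (norm_nonneg Q) (sq_nonneg ‖e‖), sq_nonneg ‖e‖, sq_nonneg ‖z‖]
  have b7 : a / 2 / (‖P‖ + ‖Q‖ + 1) * (P e e + Q z z) ≤ a / 2 * (‖e‖ ^ 2 + ‖z‖ ^ 2) := by
    calc _ ≤ a / 2 / (‖P‖ + ‖Q‖ + 1) * ((‖P‖ + ‖Q‖ + 1) * (‖e‖ ^ 2 + ‖z‖ ^ 2)) := by gcongr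
      _ = _ := by field_simp
  simp only [map_add, map_sub, map_smul, smul_eq_mul]
  linarith

/-- A system with slow error `e` and fast error `z` (the deviation from the quasi-steady state
`H e`) is exponentially stable for small time-scale ratios `ε` if the slow system restricted to
`z = 0` and the fast system with frozen `e` have quadratic Lyapunov functions. The coordinates are
`e = S (x - xbar)` and `z = Y (x - xbar)`. -/
theorem exists_exponentiallyStable_of_singular_perturbation {E : Type*} [NormedAddCommGroup E]
    [NormedSpace ℝ E] [CompleteSpace E] {S : E →L[ℝ] X} {Y : E →L[ℝ] Z}
    {f₀ : X → X} {g : X → Z} {B : Z →L[ℝ] X} {H : X →L[ℝ] Z} {R : Z →L[ℝ] Z}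
    {P : X →L[ℝ] X →L[ℝ] ℝ} {Q : Z →L[ℝ] Z →L[ℝ] ℝ}
    (hP : ∀ x y, P x y = P y x) (hQ : ∀ x y, Q x y = Q y x)
    {cE cP cQ a γ C : ℝ} (hcE : 0 < cE) (hcP : 0 < cP) (hcQ : 0 < cQ) (ha : 0 < a) (hγ : 0 < γ)
    (hSY : ∀ x, cE * ‖x‖ ^ 2 ≤ ‖S x‖ ^ 2 + ‖Y x‖ ^ 2)
    (hPc : ∀ x, cP * ‖x‖ ^ 2 ≤ P x x) (hQc : ∀ y, cQ * ‖y‖ ^ 2 ≤ Q y y)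
    (hf : ∀ᶠ e in nhds 0, P e (f₀ e) ≤ -a * ‖e‖ ^ 2) (hf' : ∀ᶠ e in nhds 0, ‖f₀ e‖ ≤ C * ‖e‖)
    (hg : ∀ η > 0, ∀ᶠ e in nhds 0, ‖g e‖ ≤ η * ‖e‖) (hR : ∀ y, Q y (R y) ≤ -γ * ‖y‖ ^ 2)
    {xbar : E} {F : ℝ → E → E} (hlip : ∀ ε, LocallyLipschitz (F ε))
    (hFS : ∀ ε x, S (F ε x) = f₀ (S (x - xbar)) + B (Y (x - xbar)))
    (hFY : ∀ ε x, Y (F ε x) = ε⁻¹ • (R (Y (x - xbar)) + g (S (x - xbar)))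
      - H (f₀ (S (x - xbar)) + B (Y (x - xbar)))) :
    ∃ εstar > 0, ∀ ε, 0 < ε → ε < εstar → ExponentiallyStable (F ε) xbar := by
  set C' := max C 0
  have hC' : 0 ≤ C' := le_max_right _ _
  have hD : 0 < ‖Q‖ * ‖H‖ * ‖B‖ + (‖P‖ * ‖B‖ + ‖Q‖ * ‖H‖ * C' + ‖Q‖) ^ 2 / (2 * a) + a / 2 := by
    positivity
  refine ⟨γ / _, div_pos hγ hD, fun ε hε hεs => ?_⟩
  have hγε := ((lt_div_iff₀ hD).1 hεs).le
  rw [mul_comm, ← le_div_iff₀ hε] at hγε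
  have hzero : f₀ 0 = 0 ∧ g 0 = 0 := by
    have h1 := hf'.self_of_nhds
    have h2 := (hg 1 one_pos).self_of_nhds
    simpa using And.intro h1 h2
  have hF0 : F ε xbar = 0 := by
    have h1 := hSY (F ε xbar)
    rw [hFS, hFY] at h1
    simp only [sub_self, map_zero, hzero.1, hzero.2, add_zero, smul_zero, norm_zero, ne_eq,
      OfNat.ofNat_ne_zero, not_false_eq_true, zero_pow] at h1
    have h2 : ‖F ε xbar‖ ^ 2 ≤ 0 := by
      by_contra h
      exact absurd h1 (not_le.2 (mul_pos hcE (not_le.1 h)))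
    exact norm_eq_zero.1 (pow_eq_zero_iff two_ne_zero |>.1 (le_antisymm h2 (sq_nonneg _)))
  obtain ⟨K, s, hs, hsK⟩ := hlip ε xbar
  have hev : ∀ᶠ e in nhds (0 : X), P e (f₀ e) ≤ -a * ‖e‖ ^ 2 ∧ ‖f₀ e‖ ≤ C' * ‖e‖ ∧
      ‖g e‖ ≤ ε * ‖e‖ := by
    -- Taking `η = ε` in `hg` cancels the factor `ε⁻¹` in front of the remainder. The ball shrinks
    -- with `ε`, but the threshold on `ε` does not depend on the ball.
    filter_upwards [hf, hf', hg ε hε] with e h1 h2 h3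
    exact ⟨h1, h2.trans (mul_le_mul_of_nonneg_right (le_max_left _ _) (norm_nonneg _)), h3⟩
  have hev' : ∀ᶠ x in nhds xbar, P (S (x - xbar)) (f₀ (S (x - xbar))) ≤ -a * ‖S (x - xbar)‖ ^ 2 ∧
      ‖f₀ (S (x - xbar))‖ ≤ C' * ‖S (x - xbar)‖ ∧ ‖g (S (x - xbar))‖ ≤ ε * ‖S (x - xbar)‖ := by
    have h : Filter.Tendsto (fun x => S (x - xbar)) (nhds xbar) (nhds 0) := by
      have : Continuous fun x => S (x - xbar) := by fun_prop
      simpa using this.tendsto xbar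
    exact h.eventually hev
  obtain ⟨r, hr, hrs⟩ := Metric.nhds_basis_closedBall.mem_iff.1 (Filter.inter_mem hs hev')
  set W : E →L[ℝ] E →L[ℝ] ℝ := P.bilinearComp S S + Q.bilinearComp Y Y
  have hW : ∀ x x', W x x' = P (S x) (S x') + Q (Y x) (Y x') := fun x x' => rfl
  have hmin : 0 < min cP cQ := lt_min hcP hcQ
  refine exponentiallyStable_of_quadratic_lyapunov (K := K) (r := r) (W := W)
    (c := min cP cQ * cE) (μ := a / 2 / (‖P‖ + ‖Q‖ + 1)) hF0 hr
    (by positivity) (by positivity) (hsK.mono (hrs.trans inter_subset_left))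
    (fun x x' => by rw [hW, hW, hP, hQ]) (fun x => ?_) (fun x hx => ?_)
  · calc _ = min cP cQ * (cE * ‖x‖ ^ 2) := by ring
      _ ≤ min cP cQ * (‖S x‖ ^ 2 + ‖Y x‖ ^ 2) := by
          gcongr
          exact hSY x
      _ = min cP cQ * ‖S x‖ ^ 2 + min cP cQ * ‖Y x‖ ^ 2 := by ring
      _ ≤ cP * ‖S x‖ ^ 2 + cQ * ‖Y x‖ ^ 2 := by
          gcongr
          · exact min_le_left _ _
          · exact min_le_right _ _
      _ ≤ W x x := add_le_add (hPc _) (hQc _)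
  · obtain ⟨h1, h2, h3⟩ := (hrs (mem_closedBall_iff_norm.2 hx)).2
    rw [hW, hW, hFS, hFY]
    exact slow_fast_bilinear_decay ha hε hγε h1 h2 h3 (hR _)

end SingularPerturbation

/-! ### Coercivity and a monotone equation -/

/-- The constant is the minimum of `q` on the compact unit sphere. The sphere is empty for the zero
space, which occurs as `Fin 0 → ℝ` when there is one inverter. -/
theorem exists_pos_mul_norm_sq_le {E : Type*} [NormedAddCommGroup E] [NormedSpace ℝ E]
    [FiniteDimensional ℝ E] {q : E → ℝ} (hq : Continuous q)
    (hsmul : ∀ (t : ℝ) x, q (t • x) = t ^ 2 * q x) (hpos : ∀ x, x ≠ 0 → 0 < q x) :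
    ∃ c > 0, ∀ x, c * ‖x‖ ^ 2 ≤ q x := by
  have hq0 : q 0 = 0 := by simpa using hsmul 0 0
  have : ProperSpace E := FiniteDimensional.proper ℝ E
  by_cases hne : (Metric.sphere (0 : E) 1).Nonempty
  · obtain ⟨x₀, hx₀, hmin⟩ := (isCompact_sphere (0 : E) 1).exists_isMinOn hne hq.continuousOn
    have hx₀' : x₀ ≠ 0 := by
      rintro rfl
      simp at hx₀
    refine ⟨q x₀, hpos _ hx₀', fun x => ?_⟩
    by_cases hx : x = 0
    · simp [hx, hq0]
    · have hn : ‖x‖ ≠ 0 := norm_ne_zero_iff.2 hx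
      have h1 : q x₀ ≤ q (‖x‖⁻¹ • x) := hmin (by simp [norm_smul, hn])
      rw [hsmul] at h1
      calc q x₀ * ‖x‖ ^ 2 ≤ (‖x‖⁻¹ ^ 2 * q x) * ‖x‖ ^ 2 := by gcongr
        _ = q x := by field_simp
  · refine ⟨1, one_pos, fun x => ?_⟩
    have hx : x = 0 := by
      by_contra hx
      exact hne ⟨‖x‖⁻¹ • x, by simp [norm_smul, norm_ne_zero_iff.2 hx]⟩
    simp [hx, hq0]

/-- Fixed points of maps that contract a quadratic functional equivalent to the squared norm. -/
theorem exists_fixedPoint_of_quadratic_contraction {E : Type*} [NormedAddCommGroup E]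
    [CompleteSpace E] {F : E → E} {W : E → ℝ} {c C k : ℝ} (hc : 0 < c)
    (hk0 : 0 ≤ k) (hk : k < 1) (hlow : ∀ x, c * ‖x‖ ^ 2 ≤ W x) (hup : ∀ x, W x ≤ C * ‖x‖ ^ 2)
    (hF : ∀ x y, W (F x - F y) ≤ k * W (x - y)) : ∃ x, F x = x := by
  have hbound : ∀ n x y, ‖F^[n] x - F^[n] y‖ ≤ Real.sqrt (W (x - y) / c) * Real.sqrt k ^ n := by
    intro n x y
    have h1 : W (F^[n] x - F^[n] y) ≤ k ^ n * W (x - y) := by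
      induction n with
      | zero => simp
      | succ n ih =>
        rw [Function.iterate_succ_apply', Function.iterate_succ_apply']
        calc _ ≤ k * W (F^[n] x - F^[n] y) := hF _ _
          _ ≤ k * (k ^ n * W (x - y)) := by gcongr
          _ = _ := by ring
    have hW : 0 ≤ W (x - y) := (by positivity : 0 ≤ c * ‖x - y‖ ^ 2).trans (hlow _)
    refine le_of_sq_le_sq ?_ (by positivity)
    rw [mul_pow, Real.sq_sqrt (by positivity), ← pow_mul, mul_comm n, pow_mul, Real.sq_sqrt hk0,
      div_mul_eq_mul_div, le_div_iff₀ hc]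
    linarith [hlow (F^[n] x - F^[n] y)]
  have hcauchy : CauchySeq fun n => F^[n] 0 := by
    refine cauchySeq_of_le_geometric (Real.sqrt k) (Real.sqrt (W (0 - F 0) / c))
      (by rw [Real.sqrt_lt' one_pos]; simpa using hk) fun n => ?_
    rw [dist_eq_norm, Function.iterate_succ_apply]
    exact hbound n 0 (F 0)
  obtain ⟨x, hx⟩ := cauchySeq_tendsto_of_complete hcauchy
  refine ⟨x, isFixedPt_of_tendsto_iterate hx (Continuous.continuousAt ?_)⟩
  have hlip : LipschitzWith (Real.sqrt (k * C / c)).toNNReal F := by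
    refine LipschitzWith.of_dist_le_mul fun x y => ?_
    rw [dist_eq_norm, dist_eq_norm, Real.coe_toNNReal _ (Real.sqrt_nonneg _)]
    by_cases hxy : x = y
    · simp [hxy]
    have hC : 0 ≤ C := by
      have h1 := (hlow (x - y)).trans (hup (x - y))
      have h2 : 0 < ‖x - y‖ ^ 2 := pow_pos (norm_pos_iff.2 (sub_ne_zero.2 hxy)) 2
      exact hc.le.trans (le_of_mul_le_mul_right h1 h2)
    refine le_of_sq_le_sq ?_ (by positivity)
    rw [mul_pow, Real.sq_sqrt (by positivity), div_mul_eq_mul_div, le_div_iff₀ hc]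
    have := mul_le_mul_of_nonneg_left (hup (x - y)) hk0
    linarith [hlow (F x - F y), hF x y]
  exact hlip.continuous

/-- If `diag d * A` has negative definite symmetric part, then `A φ(v) + b = ψ(v)` is solvable for
componentwise monotone `φ` and `ψ` with `ψ` coercive. -/
theorem exists_mulVec_add_eq {ι : Type*} [Fintype ι] {A : Matrix ι ι ℝ} {d : ι → ℝ}
    (hd : ∀ i, 0 < d i) (hA : ∀ x : ι → ℝ, x ≠ 0 → ∑ i, d i * x i * (A *ᵥ x) i < 0)
    {φ ψ : ι → ℝ → ℝ} (hφ : ∀ i, Monotone (φ i)) (hφc : ∀ i, Continuous (φ i))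
    (hψ : ∀ i, Monotone (ψ i)) (hψc : ∀ i, Continuous (ψ i))
    (htop : ∀ i, Filter.Tendsto (ψ i) Filter.atTop Filter.atTop)
    (hbot : ∀ i, Filter.Tendsto (ψ i) Filter.atBot Filter.atBot) (b : ι → ℝ) :
    ∃ v : ι → ℝ, ∀ i, (A *ᵥ fun j => φ j (v j)) i + b i = ψ i (v i) := by
  set W : (ι → ℝ) → ℝ := fun x => ∑ i, d i * x i ^ 2 with hW
  obtain ⟨cW, hcW, hWlow⟩ := exists_pos_mul_norm_sq_le (q := W) (by fun_prop)
    (fun t x => by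
      simp only [hW, Pi.smul_apply, smul_eq_mul, Finset.mul_sum]
      exact Finset.sum_congr rfl fun i _ => by ring)
    (fun x hx => by
      obtain ⟨i, hi⟩ := Function.ne_iff.1 hx
      refine Finset.sum_pos' (fun j _ => mul_nonneg (hd j).le (sq_nonneg _))
        ⟨i, Finset.mem_univ _, mul_pos (hd i) (sq_pos_of_ne_zero hi)⟩)
  obtain ⟨cA, hcA, hAlow⟩ := exists_pos_mul_norm_sq_le
    (q := fun x : ι → ℝ => -∑ i, d i * x i * (A *ᵥ x) i) (by fun_prop)
    (fun t x => by
      simp only [Matrix.mulVec_smul, Pi.smul_apply, smul_eq_mul, mul_neg, Finset.mul_sum]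
      exact congrArg _ (Finset.sum_congr rfl fun i _ => by ring))
    (fun x hx => neg_pos.2 (hA x hx))
  set D : ℝ := ∑ i, d i with hD
  have hD0 : 0 ≤ D := Finset.sum_nonneg fun i _ => (hd i).le
  have hWup : ∀ x, W x ≤ D * ‖x‖ ^ 2 := fun x => by
    rw [hD, Finset.sum_mul]
    refine Finset.sum_le_sum fun i _ => mul_le_mul_of_nonneg_left ?_ (hd i).le
    rw [← sq_abs]
    exact pow_le_pow_left₀ (abs_nonneg _) (norm_le_pi_norm x i) 2
  set L := ‖A.mulVecLin.toContinuousLinearMap‖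
  have hL : ∀ x, ‖A *ᵥ x‖ ≤ L * ‖x‖ := A.mulVecLin.toContinuousLinearMap.le_opNorm
  -- This step size keeps the quadratic term of the forward step below `s * cA * ‖x‖ ^ 2`, half of
  -- the linear gain.
  set s : ℝ := cA / (D * L ^ 2 + 1) with hs
  have hs0 : 0 < s := by positivity
  have hsle : s * (D * L ^ 2) ≤ cA := by
    calc s * (D * L ^ 2) ≤ s * (D * L ^ 2 + 1) := by gcongr; linarith
      _ = cA := by rw [hs]; field_simp
  have hstep : ∀ x, W (x + s • (A *ᵥ x)) ≤ (1 - s * cA / (D + 1)) * W x := by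
    intro x
    have e : W (x + s • (A *ᵥ x)) = W x + 2 * s * (∑ i, d i * x i * (A *ᵥ x) i)
        + s ^ 2 * W (A *ᵥ x) := by
      simp only [hW, Finset.mul_sum, ← Finset.sum_add_distrib]
      refine Finset.sum_congr rfl fun i _ => ?_
      simp only [Pi.add_apply, Pi.smul_apply, smul_eq_mul]
      ring
    have h1 : W (A *ᵥ x) ≤ D * L ^ 2 * ‖x‖ ^ 2 := by
      refine (hWup _).trans ?_
      rw [mul_assoc, ← mul_pow]
      gcongr
      exact hL x
    have h2 : s ^ 2 * W (A *ᵥ x) ≤ s * cA * ‖x‖ ^ 2 := by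
      calc s ^ 2 * W (A *ᵥ x) ≤ s ^ 2 * (D * L ^ 2 * ‖x‖ ^ 2) := by gcongr
        _ = s * (s * (D * L ^ 2)) * ‖x‖ ^ 2 := by ring
        _ ≤ s * cA * ‖x‖ ^ 2 := by gcongr
    have h3 : 2 * s * (∑ i, d i * x i * (A *ᵥ x) i) ≤ -(2 * s * cA * ‖x‖ ^ 2) := by
      have := mul_le_mul_of_nonneg_left (hAlow x) (by positivity : 0 ≤ 2 * s)
      linarith
    have h4 : s * cA / (D + 1) * W x ≤ s * cA * ‖x‖ ^ 2 := by
      calc _ ≤ s * cA / (D + 1) * ((D + 1) * ‖x‖ ^ 2) := by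
            gcongr
            nlinarith [hWup x, sq_nonneg ‖x‖]
        _ = _ := by field_simp
    rw [e]
    linarith
  -- Resolvent by the intermediate value theorem. A right inverse `G` is enough: monotonicity of `φ`
  -- and `ψ` makes `φ ∘ G` nonexpansive.
  have hex : ∀ i w, ∃ v, φ i v + s * ψ i v = w := fun i => by
    have hc : Continuous fun v => φ i v + s * ψ i v := (hφc i).add (continuous_const.mul (hψc i))
    refine hc.surjective ?_ ?_
    · refine Filter.tendsto_atTop_add_left_of_le' _ (φ i 0) ?_ ((htop i).const_mul_atTop hs0)
      filter_upwards [Filter.eventually_ge_atTop 0] with v hv using hφ i hv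
    · refine Filter.tendsto_atBot_add_left_of_ge' _ (φ i 0) ?_ ((hbot i).const_mul_atBot hs0)
      filter_upwards [Filter.eventually_le_atBot 0] with v hv using hφ i hv
  choose G hG using hex
  have hnonexp : ∀ i w w', (φ i (G i w) - φ i (G i w')) ^ 2 ≤ (w - w') ^ 2 := by
    intro i w w'
    have h1 : 0 ≤ (φ i (G i w) - φ i (G i w')) * (ψ i (G i w) - ψ i (G i w')) := by
      rcases le_total (G i w) (G i w') with h | h
      · exact mul_nonneg_of_nonpos_of_nonpos (sub_nonpos.2 (hφ i h)) (sub_nonpos.2 (hψ i h))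
      · exact mul_nonneg (sub_nonneg.2 (hφ i h)) (sub_nonneg.2 (hψ i h))
    have h2 : w - w' = (φ i (G i w) - φ i (G i w')) + s * (ψ i (G i w) - ψ i (G i w')) := by
      linarith [hG i w, hG i w']
    rw [h2]
    nlinarith [mul_nonneg hs0.le h1, sq_nonneg (s * (ψ i (G i w) - ψ i (G i w')))]
  -- Forward-backward iteration: an explicit step with `A`, then the resolvent. At a fixed point, `φ
  -- v = V` and `φ v + s ψ v = V + s (A V + b)`; subtracting gives the equation.
  obtain ⟨V, hV⟩ := exists_fixedPoint_of_quadratic_contraction (W := W) (c := cW) (C := D)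
    (k := max 0 (1 - s * cA / (D + 1)))
    (F := fun V i => φ i (G i ((V + s • (A *ᵥ V + b)) i))) hcW (le_max_left _ _)
    (max_lt one_pos (sub_lt_self _ (by positivity))) hWlow hWup (fun x y => by
      calc _ ≤ W (x - y + s • (A *ᵥ (x - y))) := by
            refine Finset.sum_le_sum fun i _ => mul_le_mul_of_nonneg_left ?_ (hd i).le
            refine (hnonexp i _ _).trans (le_of_eq ?_)
            simp only [Matrix.mulVec_sub, Pi.add_apply, Pi.sub_apply, Pi.smul_apply, smul_eq_mul]
            ring
        _ ≤ _ := (hstep _).trans (mul_le_mul_of_nonneg_right (le_max_right _ _)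
            (Finset.sum_nonneg fun i _ => mul_nonneg (hd i).le (sq_nonneg _))))
  refine ⟨fun i => G i ((V + s • (A *ᵥ V + b)) i), fun i => ?_⟩
  have h1 : (fun j => φ j (G j ((V + s • (A *ᵥ V + b)) j))) = V := hV
  have h2 := hG i ((V + s • (A *ᵥ V + b)) i)
  rw [show φ i (G i ((V + s • (A *ᵥ V + b)) i)) = V i from congrFun hV i] at h2
  rw [h1]
  simp only [Pi.add_apply, Pi.smul_apply, smul_eq_mul, add_right_inj] at h2 ⊢
  exact (mul_left_cancel₀ hs0.ne' h2).symm

/-! ### The saturation and leakage functions -/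

theorem Real.hasDerivAt_tanh (x : ℝ) : HasDerivAt Real.tanh (1 / Real.cosh x ^ 2) x := by
  have h := (Real.hasDerivAt_sinh x).div (Real.hasDerivAt_cosh x) (Real.cosh_pos x).ne'
  have e : Real.tanh = Real.sinh / Real.cosh := funext Real.tanh_eq_sinh_div_cosh
  rw [e]
  refine h.congr_deriv ?_
  rw [← Real.cosh_sq_sub_sinh_sq x]
  ring

theorem Real.contDiff_tanh {n : WithTop ℕ∞} : ContDiff ℝ n Real.tanh := by
  have e : Real.tanh = fun x => Real.sinh x / Real.cosh x := funext Real.tanh_eq_sinh_div_cosh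
  rw [e]
  exact Real.contDiff_sinh.div Real.contDiff_cosh fun x => (Real.cosh_pos x).ne'

/-- The function is odd, and on the positive half-line it is a product of nonnegative nondecreasing
factors. -/
theorem monotone_max_abs_sub_mul {δ : ℝ} (hδ : 0 < δ) :
    Monotone fun v : ℝ => max (|v / δ| - 3) 0 * v := by
  have key : ∀ u v : ℝ, 0 ≤ u → u ≤ v → max (|u / δ| - 3) 0 * u ≤ max (|v / δ| - 3) 0 * v := by
    intro u v hu huv
    have h : |u / δ| ≤ |v / δ| := by
      rw [abs_of_nonneg (by positivity), abs_of_nonneg (div_nonneg (hu.trans huv) hδ.le)]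
      gcongr
    exact mul_le_mul (max_le_max (by linarith) le_rfl) huv hu (le_max_right _ _)
  intro u v huv
  rcases le_total 0 u with hu | hu
  · exact key u v hu huv
  · rcases le_total 0 v with hv | hv
    · exact (mul_nonpos_of_nonneg_of_nonpos (le_max_right _ _) hu).trans
        (mul_nonneg (le_max_right _ _) hv)
    · have h := key (-v) (-u) (neg_nonneg.2 hv) (neg_le_neg huv)
      simp only [neg_div, abs_neg, mul_neg, neg_le_neg_iff] at h
      exact h

theorem tendsto_max_abs_sub_mul_atTop {δ : ℝ} (hδ : 0 < δ) :
    Filter.Tendsto (fun v : ℝ => max (|v / δ| - 3) 0 * v) Filter.atTop Filter.atTop := by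
  refine Filter.tendsto_atTop_mono' _ ?_ Filter.tendsto_id
  filter_upwards [Filter.eventually_ge_atTop (4 * δ)] with v hv
  have hv0 : 0 ≤ v := (by positivity : 0 ≤ 4 * δ).trans hv
  have h : 1 ≤ max (|v / δ| - 3) 0 := by
    refine le_max_of_le_left ?_
    have : 4 ≤ v / δ := by rwa [le_div_iff₀ hδ]
    linarith [le_abs_self (v / δ)]
  exact le_mul_of_one_le_left hv0 h

theorem tendsto_max_abs_sub_mul_atBot {δ : ℝ} (hδ : 0 < δ) :
    Filter.Tendsto (fun v : ℝ => max (|v / δ| - 3) 0 * v) Filter.atBot Filter.atBot := by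
  have h := (tendsto_max_abs_sub_mul_atTop hδ).comp Filter.tendsto_neg_atBot_atTop
  have h' := Filter.tendsto_neg_atTop_atBot.comp h
  refine h'.congr fun v => ?_
  simp [neg_div]

/-! ### The coordinate change and the Laplacian -/

theorem Tmat_mulVec_zero {N : ℕ} (x : Fin (N + 1) → ℝ) :
    (Tmat N *ᵥ x) 0 = (1 / ((N : ℝ) + 1)) * ∑ i, x i := by
  simp [Tmat, Matrix.mulVec, dotProduct, Finset.mul_sum]

theorem Tmat_mulVec_succ {N : ℕ} (x : Fin (N + 1) → ℝ) (i : Fin N) :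
    (Tmat N *ᵥ x) i.succ = x i.succ - x i.castSucc := by
  have hne : i.castSucc ≠ i.succ := (Fin.castSucc_lt_succ).ne
  have h : ∀ j, Tmat N i.succ j
      = (if j = i.succ then 1 else 0) - (if j = i.castSucc then 1 else 0) := by
    intro j
    simp only [Tmat, Matrix.of_apply, Fin.cases_succ]
    split_ifs with h1 h2 <;> simp_all
  simp [Matrix.mulVec, dotProduct, h, sub_mul, Finset.sum_sub_distrib]

theorem Tmat_mulVec_const {N : ℕ} (c : ℝ) :
    Tmat N *ᵥ (fun _ => c) = Pi.single 0 c := by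
  ext i
  refine Fin.cases ?_ (fun i => ?_) i
  · rw [Tmat_mulVec_zero]
    simp
    field_simp
  · rw [Tmat_mulVec_succ]
    simp

theorem isUnit_of_mulVec_injective {n : Type*} [Fintype n] [DecidableEq n] {A : Matrix n n ℝ}
    (h : ∀ x, A *ᵥ x = 0 → x = 0) : IsUnit A := by
  rw [← Matrix.mulVec_injective_iff_isUnit]
  intro x y hxy
  exact sub_eq_zero.1 (h _ (by rw [Matrix.mulVec_sub]; exact sub_eq_zero.2 hxy))

theorem isUnit_Tmat (N : ℕ) : IsUnit (Tmat N) := by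
  refine isUnit_of_mulVec_injective fun x hx => ?_
  have hs : ∀ i : Fin N, x i.succ = x i.castSucc := fun i => by
    have := congrFun hx i.succ
    rw [Tmat_mulVec_succ] at this
    exact sub_eq_zero.1 this
  have hc : ∀ i, x i = x 0 := fun i => by
    induction i using Fin.induction with
    | zero => rfl
    | succ i ih => rw [hs, ih]
  have h0 := congrFun hx 0
  rw [Tmat_mulVec_zero, Finset.sum_congr rfl fun i _ => hc i] at h0
  have hN : (N : ℝ) + 1 ≠ 0 := by positivity
  have : x 0 = 0 := by simpa [hN] using h0
  ext i
  rw [hc, this, Pi.zero_apply]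

theorem Ir_mulVec {N : ℕ} (x : Fin (N + 1) → ℝ) (i : Fin N) : (Ir N *ᵥ x) i = x i.succ := by
  simp [Ir, Matrix.mulVec, dotProduct]

theorem Ir_transpose_mulVec {N : ℕ} (z : Fin N → ℝ) : (Ir N)ᵀ *ᵥ z = Fin.cons 0 z := by
  ext i
  refine Fin.cases ?_ (fun i => ?_) i
  · simp [Ir, Matrix.mulVec, dotProduct, Fin.succ_ne_zero, eq_comm]
  · simp [Ir, Matrix.mulVec, dotProduct]

/-- Vector of zero mean with prescribed consecutive differences. -/
def relLift (N : ℕ) : Matrix (Fin (N + 1)) (Fin N) ℝ := (Tmat N)⁻¹ * (Ir N)ᵀ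

theorem Tmat_mulVec_relLift {N : ℕ} (z : Fin N → ℝ) :
    Tmat N *ᵥ (relLift N *ᵥ z) = Fin.cons 0 z := by
  rw [relLift, Matrix.mulVec_mulVec, ← Matrix.mul_assoc,
    Matrix.mul_nonsing_inv _ ((Matrix.isUnit_iff_isUnit_det _).1 (isUnit_Tmat N)), Matrix.one_mul,
    Ir_transpose_mulVec]

theorem sum_relLift {N : ℕ} (z : Fin N → ℝ) : ∑ i, (relLift N *ᵥ z) i = 0 := by
  have h := congrFun (Tmat_mulVec_relLift z) 0
  rw [Tmat_mulVec_zero, Fin.cons_zero] at h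
  have hN : (1 : ℝ) / ((N : ℝ) + 1) ≠ 0 := by positivity
  exact (mul_eq_zero.1 h).resolve_left hN

theorem eq_zero_of_relLift_const {N : ℕ} {z : Fin N → ℝ} (h : ∀ i j, (relLift N *ᵥ z) i
    = (relLift N *ᵥ z) j) : z = 0 := by
  ext i
  have h1 := congrFun (Tmat_mulVec_relLift z) i.succ
  rw [Tmat_mulVec_succ, h i.succ i.castSucc, sub_self, Fin.cons_succ] at h1
  exact h1.symm

/-- `relLift` is a left inverse, up to the mean, of taking consecutive differences. -/
theorem relLift_mulVec_diff {N : ℕ} (w : Fin (N + 1) → ℝ) :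
    relLift N *ᵥ (Ir N *ᵥ (Tmat N *ᵥ w)) = w - fun _ => (Tmat N *ᵥ w) 0 := by
  have hT := Matrix.mulVec_injective_iff_isUnit.2 (isUnit_Tmat N)
  refine hT ?_
  rw [Tmat_mulVec_relLift, Matrix.mulVec_sub, Tmat_mulVec_const]
  ext i
  refine Fin.cases ?_ (fun i => ?_) i
  · simp
  · simp [Ir_mulVec, -Matrix.mulVec_mulVec]

/-- Taking differences and lifting back only subtracts the mean, which a vector of zero mean does
not see. This removes the coordinate change from the form of `Rζ`. -/
theorem relLift_dotProduct_relLift_diff {N : ℕ} (z : Fin N → ℝ) (w : Fin (N + 1) → ℝ) :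
    (relLift N *ᵥ z) ⬝ᵥ (relLift N *ᵥ (Ir N *ᵥ (Tmat N *ᵥ w))) = (relLift N *ᵥ z) ⬝ᵥ w := by
  rw [relLift_mulVec_diff, dotProduct_sub, sub_eq_self]
  simp only [dotProduct, ← Finset.sum_mul, sum_relLift, zero_mul]

namespace Microgrid

variable {N : ℕ} (M : Microgrid N)

theorem lap_transpose : M.lapᵀ = M.lap := by
  rw [lap, Matrix.transpose_sub, Matrix.diagonal_transpose, M.a_symm]

/-- Symmetrizing the double sum gives the Dirichlet form, the source of both semidefiniteness and
the kernel of the Laplacian. -/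
theorem dotProduct_lap_mulVec (x : Fin (N + 1) → ℝ) :
    x ⬝ᵥ (M.lap *ᵥ x) = (∑ i, ∑ j, M.a i j * (x i - x j) ^ 2) / 2 := by
  have hs : ∀ i j, M.a i j = M.a j i := fun i j => M.a_symm.apply j i
  have h1 : x ⬝ᵥ (M.lap *ᵥ x) = ∑ i, ∑ j, M.a i j * (x i ^ 2 - x i * x j) := by
    refine Finset.sum_congr rfl fun i _ => ?_
    rw [lap, Matrix.sub_mulVec, Pi.sub_apply, Matrix.mulVec_diagonal]
    simp only [Matrix.mulVec, dotProduct, Finset.mul_sum, Finset.sum_mul, mul_sub (x i),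
      ← Finset.sum_sub_distrib]
    exact Finset.sum_congr rfl fun j _ => by ring
  have h2 : ∑ i, ∑ j, M.a i j * (x i ^ 2 - x i * x j)
      = ∑ i, ∑ j, M.a i j * (x j ^ 2 - x i * x j) := by
    rw [Finset.sum_comm]
    refine Finset.sum_congr rfl fun i _ => Finset.sum_congr rfl fun j _ => ?_
    rw [hs j i]
    ring
  have h3 : ∑ i, ∑ j, M.a i j * (x i - x j) ^ 2
      = ∑ i, ∑ j, M.a i j * (x i ^ 2 - x i * x j) + ∑ i, ∑ j, M.a i j * (x j ^ 2 - x i * x j) := by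
    simp only [← Finset.sum_add_distrib]
    exact Finset.sum_congr rfl fun i _ => Finset.sum_congr rfl fun j _ => by ring
  rw [h1, h3, ← h2]
  ring

theorem lap_posSemidef : M.lap.PosSemidef := by
  refine Matrix.PosSemidef.of_dotProduct_mulVec_nonneg ?_ fun x => ?_
  · rw [Matrix.IsHermitian, Matrix.conjTranspose_eq_transpose_of_trivial, lap_transpose]
  · rw [star_trivial, dotProduct_lap_mulVec]
    have := Finset.sum_nonneg fun i (_ : i ∈ Finset.univ) => Finset.sum_nonneg
      fun j (_ : j ∈ Finset.univ) => mul_nonneg (M.a_nonneg i j) (sq_nonneg (x i - x j))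
    positivity

/-- Every term of the Dirichlet form vanishes, so `x` agrees across each edge and hence along paths
of the connected graph. -/
theorem const_of_lap_mulVec_eq_zero {x : Fin (N + 1) → ℝ} (h : M.lap *ᵥ x = 0) (i j) :
    x i = x j := by
  have h0 := M.dotProduct_lap_mulVec x
  rw [h, dotProduct_zero] at h0
  have hnn : ∀ i j, 0 ≤ M.a i j * (x i - x j) ^ 2 := fun i j =>
    mul_nonneg (M.a_nonneg i j) (sq_nonneg _)
  have hsum : ∑ i, ∑ j, M.a i j * (x i - x j) ^ 2 = 0 := by linarith
  have hzero : ∀ i j, M.a i j * (x i - x j) ^ 2 = 0 := fun i j =>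
    (Finset.sum_eq_zero_iff_of_nonneg fun j _ => hnn i j).1
      ((Finset.sum_eq_zero_iff_of_nonneg fun i _ => Finset.sum_nonneg fun j _ => hnn i j).1 hsum i
        (Finset.mem_univ _)) j (Finset.mem_univ _)
  have hpos : ∀ i j, 0 < M.a i j → x i = x j := fun i j hij =>
    sub_eq_zero.1 (pow_eq_zero_iff two_ne_zero |>.1 ((mul_eq_zero.1 (hzero i j)).resolve_left
      hij.ne'))
  obtain ⟨p⟩ := M.a_connected.preconnected i j
  induction p with
  | nil => rfl
  | cons hadj _ ih =>
    rw [← ih]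
    rw [SimpleGraph.fromRel_adj] at hadj
    rcases hadj.2 with h' | h'
    · exact hpos _ _ h'
    · exact (hpos _ _ h').symm

theorem K_posDef : M.K.PosDef := by
  refine Matrix.PosDef.inv ?_
  exact Matrix.PosDef.one.add_posSemidef (M.lap_posSemidef.smul M.k_pos.le)

/-- Symmetry of the Laplacian moves one factor to the left and exposes the positive definite form of
`K`. -/
theorem relLift_dotProduct_Rζ (z : Fin N → ℝ) :
    (relLift N *ᵥ z) ⬝ᵥ (relLift N *ᵥ (M.Rζ *ᵥ z))
      = -(M.τv⁻¹ * ((M.lap *ᵥ (relLift N *ᵥ z)) ⬝ᵥ (M.K *ᵥ (M.lap *ᵥ (relLift N *ᵥ z))))) := by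
  have h : M.Rζ *ᵥ z = -(M.τv⁻¹ • (Ir N *ᵥ (Tmat N *ᵥ
      (M.lap *ᵥ (M.K *ᵥ (M.lap *ᵥ (relLift N *ᵥ z))))))) := by
    simp only [Rζ, relLift, Matrix.neg_mulVec, Matrix.smul_mulVec, Matrix.mulVec_mulVec,
      Matrix.mul_assoc]
  rw [h, Matrix.mulVec_neg, Matrix.mulVec_smul, dotProduct_neg, dotProduct_smul,
    relLift_dotProduct_relLift_diff, smul_eq_mul, Matrix.dotProduct_mulVec _ M.lap,
    ← Matrix.mulVec_transpose, lap_transpose]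

theorem relLift_dotProduct_Rζ_neg {z : Fin N → ℝ} (hz : z ≠ 0) :
    (relLift N *ᵥ z) ⬝ᵥ (relLift N *ᵥ (M.Rζ *ᵥ z)) < 0 := by
  have h1 : M.lap *ᵥ (relLift N *ᵥ z) ≠ 0 := fun h =>
    hz (eq_zero_of_relLift_const (M.const_of_lap_mulVec_eq_zero h))
  have h2 := M.K_posDef.dotProduct_mulVec_pos h1
  rw [star_trivial] at h2
  rw [relLift_dotProduct_Rζ, neg_lt_zero]
  exact mul_pos (inv_pos.2 M.τv_pos) h2

theorem isUnit_Rζ : IsUnit M.Rζ := by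
  refine isUnit_of_mulVec_injective fun z hz => ?_
  by_contra h
  have := M.relLift_dotProduct_Rζ_neg h
  simp [hz] at this

end Microgrid

/-! ### Regularity of the vector field -/

theorem contDiff_mulVec_comp {E m n : Type*} [NormedAddCommGroup E] [NormedSpace ℝ E] [Fintype m]
    [Fintype n] (A : Matrix m n ℝ) {f : E → n → ℝ} {k : WithTop ℕ∞} (hf : ContDiff ℝ k f) :
    ContDiff ℝ k fun x => A *ᵥ f x :=
  A.mulVecLin.toContinuousLinearMap.contDiff.comp hf

theorem LocallyLipschitz.exists_eventually_norm_le {E F : Type*} [NormedAddCommGroup E]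
    [NormedAddCommGroup F] {f : E → F} (hf : LocallyLipschitz f) (h0 : f 0 = 0) :
    ∃ C : ℝ, ∀ᶠ e in nhds 0, ‖f e‖ ≤ C * ‖e‖ := by
  obtain ⟨K, s, hs, hK⟩ := hf 0
  refine ⟨K, ?_⟩
  filter_upwards [hs] with e he
  have := hK.dist_le_mul e he 0 (mem_of_mem_nhds hs)
  simpa [h0] using this

namespace Microgrid

variable {N : ℕ} (M : Microgrid N)

/-- The saturated voltage of inverter `i`. -/
def satVolt (i : Fin (N + 1)) (s : ℝ) : ℝ := M.Vstar i + M.Δ i * Real.tanh (s / M.Δ i)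

/-- The leakage term of inverter `i`. -/
def leakage (i : Fin (N + 1)) (s : ℝ) : ℝ := max (|s / M.Δ i| - 3) 0 * s

theorem Δ_pos (i : Fin (N + 1)) : 0 < M.Δ i := by
  have := M.Vmin_lt_Vmax i
  rw [Δ]
  linarith

/-- The `max` form makes continuity at the threshold, the Lipschitz bound and monotonicity visible.
-/
theorem ρ_apply (v : Fin (N + 1) → ℝ) (i) : M.ρ v i = max (|v i / M.Δ i| - 3) 0 := by
  have h := M.Δ_pos i
  rw [ρ, abs_div, abs_of_pos h]
  split_ifs with hv
  · rw [max_eq_left]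
    rw [sub_nonneg, le_div_iff₀ h]
    exact hv.le
  · rw [max_eq_right]
    rw [sub_nonpos, div_le_iff₀ h]
    exact not_lt.1 hv

theorem ρ_mul_apply (v : Fin (N + 1) → ℝ) (i) : (M.ρ v * v) i = M.leakage i (v i) := by
  rw [Pi.mul_apply, ρ_apply, leakage]

/-- Slope of the saturation of inverter `i`. -/
def satSlope (i : Fin (N + 1)) (s : ℝ) : ℝ := 1 / Real.cosh (s / M.Δ i) ^ 2

theorem satSlope_pos (i : Fin (N + 1)) (s : ℝ) : 0 < M.satSlope i s := by
  have := Real.cosh_pos (s / M.Δ i)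
  rw [satSlope]
  positivity

theorem hasDerivAt_satVolt (i : Fin (N + 1)) (s : ℝ) :
    HasDerivAt (M.satVolt i) (M.satSlope i s) s := by
  have h1 := (Real.hasDerivAt_tanh (s / M.Δ i)).comp s ((hasDerivAt_id s).div_const (M.Δ i))
  have h2 := (h1.const_mul (M.Δ i)).const_add (M.Vstar i)
  refine h2.congr_deriv ?_
  have := (M.Δ_pos i).ne'
  rw [satSlope]
  field_simp

theorem strictMono_satVolt (i : Fin (N + 1)) : StrictMono (M.satVolt i) :=
  strictMono_of_hasDerivAt_pos (M.hasDerivAt_satVolt i) (M.satSlope_pos i)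

theorem monotone_leakage (i : Fin (N + 1)) : Monotone (M.leakage i) :=
  monotone_max_abs_sub_mul (M.Δ_pos i)

theorem continuous_leakage (i : Fin (N + 1)) : Continuous (M.leakage i) := by
  unfold leakage
  fun_prop

theorem contDiff_volt {k : WithTop ℕ∞} : ContDiff ℝ k M.volt := by
  refine contDiff_pi.2 fun i => ?_
  unfold volt
  exact contDiff_const.add (contDiff_const.mul
    (Real.contDiff_tanh.comp ((contDiff_apply ℝ ℝ i).div_const _)))

theorem locallyLipschitz_ρ : LocallyLipschitz M.ρ := by
  have h : ∀ i, LipschitzWith (1 * ‖(M.Δ i)⁻¹‖₊) fun v : Fin (N + 1) → ℝ => M.ρ v i := by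
    intro i
    refine LipschitzWith.of_dist_le_mul fun v w => ?_
    rw [ρ_apply, ρ_apply, Real.dist_eq]
    refine (abs_max_sub_max_le_abs _ _ _).trans ?_
    rw [sub_sub_sub_cancel_right]
    refine (abs_abs_sub_abs_le _ _).trans ?_
    rw [← sub_div, div_eq_inv_mul, abs_mul, dist_eq_norm]
    simp only [one_mul, coe_nnnorm, Real.norm_eq_abs]
    gcongr
    exact norm_le_pi_norm (v - w) i
  have h' : LipschitzWith (∑ i, 1 * ‖(M.Δ i)⁻¹‖₊) M.ρ := by
    refine LipschitzWith.of_dist_le_mul fun v w => ?_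
    refine (dist_pi_le_iff (by positivity)).2 fun i => ((h i).dist_le_mul v w).trans ?_
    gcongr
    exact Finset.single_le_sum (f := fun i => 1 * ‖(M.Δ i)⁻¹‖₊) (fun _ _ => zero_le)
      (Finset.mem_univ i)
  exact h'.locallyLipschitz

/-- The vector field in terms of the ratio `ε` of the time constants. -/
def ratioField (ε : ℝ) (x : State N) : State N :=
  (M.rhsθ x, M.τv⁻¹ • M.rhsv x, ε⁻¹ • M.rhsζ x)

theorem contDiff_volt_state {k : WithTop ℕ∞} : ContDiff ℝ k fun x : State N => M.volt x.2.1 :=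
  M.contDiff_volt.comp (contDiff_fst.comp contDiff_snd)

theorem contDiff_rhsθ {k : WithTop ℕ∞} : ContDiff ℝ k M.rhsθ :=
  ((contDiff_mulVec_comp _ contDiff_fst).add (contDiff_mulVec_comp _ M.contDiff_volt_state)).add
    contDiff_const

theorem contDiff_rhsζ {k : WithTop ℕ∞} : ContDiff ℝ k M.rhsζ :=
  (((contDiff_mulVec_comp _ contDiff_fst).add (contDiff_mulVec_comp _ M.contDiff_volt_state)).add
    (contDiff_mulVec_comp _ (contDiff_snd.comp contDiff_snd))).add contDiff_const

theorem locallyLipschitz_state_v : LocallyLipschitz (fun x : State N => x.2.1) :=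
  (LipschitzWith.prod_fst.comp LipschitzWith.prod_snd).locallyLipschitz

theorem contDiff_rhsv_smooth_part {k : WithTop ℕ∞} : ContDiff ℝ k fun x : State N =>
    M.Rvθ *ᵥ x.1 + (M.RvV - M.β • 1) *ᵥ M.volt x.2.1 + M.Rvζ *ᵥ x.2.2 :=
  ((contDiff_mulVec_comp _ contDiff_fst).add (contDiff_mulVec_comp _ M.contDiff_volt_state)).add
    (contDiff_mulVec_comp _ (contDiff_snd.comp contDiff_snd))

theorem contDiff_sub_mul_add_const {k : WithTop ℕ∞} (c : Fin (N + 1) → ℝ) : ContDiff ℝ k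
    fun p : (Fin (N + 1) → ℝ) × (Fin (N + 1) → ℝ) × (Fin (N + 1) → ℝ) => p.1 - p.2.1 * p.2.2 + c :=
  (contDiff_fst.sub ((contDiff_fst.comp contDiff_snd).mul
    (contDiff_snd.comp contDiff_snd))).add contDiff_const

/-- Only `ρ` fails to be smooth, so the right-hand side is a smooth map applied to locally Lipschitz
ingredients. -/
theorem rhsv_eq_comp : M.rhsv
    = (fun p : (Fin (N + 1) → ℝ) × (Fin (N + 1) → ℝ) × (Fin (N + 1) → ℝ) =>
      p.1 - p.2.1 * p.2.2 + M.dv) ∘ fun x : State N =>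
        (M.Rvθ *ᵥ x.1 + (M.RvV - M.β • 1) *ᵥ M.volt x.2.1 + M.Rvζ *ᵥ x.2.2, M.ρ x.2.1, x.2.1) := by
  funext x
  rw [rhsv]
  rfl

theorem locallyLipschitz_rhsv : LocallyLipschitz M.rhsv := by
  rw [rhsv_eq_comp]
  refine (contDiff_sub_mul_add_const (k := 1) M.dv).locallyLipschitz.comp ?_
  exact (M.contDiff_rhsv_smooth_part (k := 1)).locallyLipschitz.prodMk
    ((M.locallyLipschitz_ρ.comp locallyLipschitz_state_v).prodMk locallyLipschitz_state_v)

theorem locallyLipschitz_ratioField (ε : ℝ) : LocallyLipschitz (M.ratioField ε) :=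
  M.contDiff_rhsθ.locallyLipschitz.prodMk
    (((lipschitzWith_smul M.τv⁻¹).locallyLipschitz.comp M.locallyLipschitz_rhsv).prodMk
      ((lipschitzWith_smul ε⁻¹).locallyLipschitz.comp M.contDiff_rhsζ.locallyLipschitz))

/-! ### Consequences of the linear matrix inequality -/

/-- Row of the `v`-equation after elimination of `r_ζ`. -/
def reducedRow (a : Fin N → ℝ) (b : Fin (N + 1) → ℝ) : Fin (N + 1) → ℝ :=
  M.RvθNew *ᵥ a + (M.RvVNew - M.β • 1) *ᵥ b

/-- Inserting the solution of the fast equation turns the original matrices into the `New` ones.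
This serves existence, uniqueness and the slow field alike. -/
theorem reducedRow_eq (a : Fin N → ℝ) (b : Fin (N + 1) → ℝ) :
    M.Rvθ *ᵥ a + (M.RvV - M.β • 1) *ᵥ b + M.Rvζ *ᵥ (-(M.Rζ⁻¹ *ᵥ (M.Rζθ *ᵥ a + M.RζV *ᵥ b)))
      = M.reducedRow a b := by
  simp only [reducedRow, RvθNew, RvVNew, Matrix.sub_mulVec, Matrix.mulVec_neg, Matrix.mulVec_add,
    Matrix.mulVec_mulVec, Matrix.mul_assoc]
  abel

/-- The quadratic form of the linear matrix inequality. -/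
def lmiForm (Pθ : Matrix (Fin N) (Fin N) ℝ) (d : Fin (N + 1) → ℝ) (a : Fin N → ℝ)
    (b : Fin (N + 1) → ℝ) : ℝ :=
  a ⬝ᵥ (Pθ *ᵥ (M.Rθ *ᵥ a + M.RθV *ᵥ b)) + ∑ i, d i * b i * M.reducedRow a b i

variable {M}

/-- A matrix and its transpose have the same quadratic form, so negativity of `Q + Qᵀ` is negativity
of the form of `Q`; the diagonal of `Dv` supplies the weights. -/
theorem LMIFeasible.exists_lmiForm_neg (h : M.LMIFeasible) :
    ∃ (Pθ : Matrix (Fin N) (Fin N) ℝ) (d : Fin (N + 1) → ℝ), Pθ.PosDef ∧ (∀ i, 0 < d i) ∧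
      ∀ a b, (a ≠ 0 ∨ b ≠ 0) → M.lmiForm Pθ d a b < 0 := by
  obtain ⟨Pθ, Dv, hP, hD, hDpos, hQ⟩ := h
  refine ⟨Pθ, Dv.diag, hP, fun i => hDpos.diag_pos, fun a b hab => ?_⟩
  have hne : Sum.elim a b ≠ 0 := by
    intro h0
    have ha : a = 0 := funext fun i => congrFun h0 (Sum.inl i)
    have hb : b = 0 := funext fun i => congrFun h0 (Sum.inr i)
    simp [ha, hb] at hab
  have h1 := hQ.dotProduct_mulVec_pos hne
  have h2 : Sum.elim a b ⬝ᵥ (M.Qmat Pθ Dv)ᵀ *ᵥ Sum.elim a b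
      = Sum.elim a b ⬝ᵥ M.Qmat Pθ Dv *ᵥ Sum.elim a b := by
    rw [Matrix.mulVec_transpose, dotProduct_comm, ← Matrix.dotProduct_mulVec]
  have h3 : Sum.elim a b ⬝ᵥ M.Qmat Pθ Dv *ᵥ Sum.elim a b = M.lmiForm Pθ Dv.diag a b := by
    rw [Qmat, Matrix.fromBlocks_mulVec, sumElim_dotProduct_sumElim, lmiForm]
    congr 1
    · simp only [Sum.elim_comp_inl, Sum.elim_comp_inr, Matrix.mulVec_add, Matrix.mulVec_mulVec]
    · have e : (Dv * M.RvθNew) *ᵥ a + (Dv * (M.RvVNew - M.β • 1)) *ᵥ b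
          = Matrix.diagonal Dv.diag *ᵥ M.reducedRow a b := by
        rw [hD.diagonal_diag, reducedRow, Matrix.mulVec_add, Matrix.mulVec_mulVec,
          Matrix.mulVec_mulVec]
      simp only [Sum.elim_comp_inl, Sum.elim_comp_inr, e]
      refine Finset.sum_congr rfl fun i _ => ?_
      rw [Matrix.mulVec_diagonal]
      ring
  rw [star_trivial, Matrix.neg_mulVec, Matrix.add_mulVec, dotProduct_neg, dotProduct_add, h2,
    h3] at h1
  linarith

/-! ### Existence and uniqueness of the steady state -/

variable {Pθ : Matrix (Fin N) (Fin N) ℝ} {d : Fin (N + 1) → ℝ}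

/-- For `b = 0` the form is `a ⬝ᵥ Pθ *ᵥ (Rθ *ᵥ a)`, which would vanish on a kernel vector. -/
theorem isUnit_Rθ (h : ∀ a b, (a ≠ 0 ∨ b ≠ 0) → M.lmiForm Pθ d a b < 0) : IsUnit M.Rθ := by
  refine isUnit_of_mulVec_injective fun a ha => ?_
  by_contra hne
  have := h a 0 (Or.inl hne)
  simp [lmiForm, ha] at this

theorem inv_Rζ_mulVec (z : Fin N → ℝ) : M.Rζ *ᵥ (M.Rζ⁻¹ *ᵥ z) = z := by
  rw [Matrix.mulVec_mulVec, Matrix.mul_nonsing_inv _ ((Matrix.isUnit_iff_isUnit_det _).1 M.isUnit_Rζ),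
    Matrix.one_mulVec]

theorem eq_neg_inv_of_Rζ {a c : Fin N → ℝ} {b : Fin (N + 1) → ℝ}
    (h : M.Rζθ *ᵥ a + M.RζV *ᵥ b + M.Rζ *ᵥ c = 0) :
    c = -(M.Rζ⁻¹ *ᵥ (M.Rζθ *ᵥ a + M.RζV *ᵥ b)) := by
  rw [eq_neg_of_add_eq_zero_left h, Matrix.mulVec_neg, neg_neg, Matrix.mulVec_mulVec,
    Matrix.nonsing_inv_mul _ ((Matrix.isUnit_iff_isUnit_det _).1 M.isUnit_Rζ), Matrix.one_mulVec]

theorem exists_isSteadyState (hd : ∀ i, 0 < d i)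
    (h : ∀ a b, (a ≠ 0 ∨ b ≠ 0) → M.lmiForm Pθ d a b < 0) : ∃ x, M.IsSteadyState x := by
  have hRθ : ∀ z, M.Rθ *ᵥ (M.Rθ⁻¹ *ᵥ z) = z := fun z => by
    rw [Matrix.mulVec_mulVec, Matrix.mul_nonsing_inv _
      ((Matrix.isUnit_iff_isUnit_det _).1 (isUnit_Rθ h)), Matrix.one_mulVec]
  -- Schur complement after elimination of `r_θ`. Choosing `a` so that `Rθ a + RθV b = 0` kills the
  -- first block of `lmiForm` and leaves exactly the form of `diag d * A`.
  set A : Matrix (Fin (N + 1)) (Fin (N + 1)) ℝ :=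
    M.RvVNew - M.β • 1 - M.RvθNew * M.Rθ⁻¹ * M.RθV with hA
  have hAr : ∀ b, A *ᵥ b = M.reducedRow (-(M.Rθ⁻¹ *ᵥ (M.RθV *ᵥ b))) b := fun b => by
    simp only [hA, reducedRow, Matrix.sub_mulVec, Matrix.mulVec_neg, Matrix.mulVec_mulVec,
      Matrix.mul_assoc]
    abel
  obtain ⟨v, hv⟩ := exists_mulVec_add_eq (A := A) hd
    (fun b hb => by
      have h1 := h (-(M.Rθ⁻¹ *ᵥ (M.RθV *ᵥ b))) b (Or.inr hb)
      rw [lmiForm, Matrix.mulVec_neg _ M.Rθ, hRθ, neg_add_cancel, Matrix.mulVec_zero,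
        dotProduct_zero, zero_add, ← hAr] at h1
      exact h1)
    (fun i => (M.strictMono_satVolt i).monotone)
    (fun i => continuous_iff_continuousAt.2 fun s => (M.hasDerivAt_satVolt i s).continuousAt)
    M.monotone_leakage M.continuous_leakage
    (fun i => tendsto_max_abs_sub_mul_atTop (M.Δ_pos i))
    (fun i => tendsto_max_abs_sub_mul_atBot (M.Δ_pos i))
    (M.dv - M.Rvζ *ᵥ (M.Rζ⁻¹ *ᵥ M.dζ)
      - M.RvθNew *ᵥ (M.Rθ⁻¹ *ᵥ M.dθ))
  set V := M.volt v with hV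
  set a := -(M.Rθ⁻¹ *ᵥ (M.RθV *ᵥ V + M.dθ)) with ha
  refine ⟨(a, v, -(M.Rζ⁻¹ *ᵥ (M.Rζθ *ᵥ a + M.RζV *ᵥ V)) - M.Rζ⁻¹ *ᵥ M.dζ), ?_, ?_, ?_⟩
  · simp only [rhsθ, ← hV, ha]
    rw [Matrix.mulVec_neg, hRθ]
    abel
  · have h1 : A *ᵥ V + (M.dv - M.Rvζ *ᵥ (M.Rζ⁻¹ *ᵥ M.dζ) - M.RvθNew *ᵥ (M.Rθ⁻¹ *ᵥ M.dθ))
        = M.ρ v * v := funext fun i => (hv i).trans (M.ρ_mul_apply v i).symm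
    have h2 : M.reducedRow a V = A *ᵥ V - M.RvθNew *ᵥ (M.Rθ⁻¹ *ᵥ M.dθ) := by
      rw [hAr, reducedRow, reducedRow, ha]
      simp only [Matrix.mulVec_add, Matrix.mulVec_neg, neg_add]
      abel
    simp only [rhsv, ← hV]
    rw [Matrix.mulVec_sub, ← add_sub_assoc, reducedRow_eq, h2, ← h1]
    abel
  · simp only [rhsζ, ← hV]
    rw [Matrix.mulVec_sub, Matrix.mulVec_neg _ M.Rζ, inv_Rζ_mulVec, inv_Rζ_mulVec]
    abel

/-- Each weight has the sign of `v i - v' i`, hence that of the leakage difference; where `v i = v'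
i` the term is zero. -/
theorem sum_leakage_nonneg {w : Fin (N + 1) → ℝ} {v v' : Fin (N + 1) → ℝ}
    (hw : ∀ i, 0 ≤ w i * (v i - v' i)) : 0 ≤ ∑ i, w i * (M.leakage i (v i) - M.leakage i (v' i)) := by
  refine Finset.sum_nonneg fun i _ => ?_
  have hm := M.monotone_leakage i
  rcases lt_trichotomy (v i) (v' i) with h | h | h
  · have h1 : w i ≤ 0 := by
      by_contra h'
      exact absurd (hw i) (not_le.2 (mul_neg_of_pos_of_neg (not_le.1 h') (sub_neg.2 h)))
    exact mul_nonneg_of_nonpos_of_nonpos h1 (sub_nonpos.2 (hm h.le))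
  · rw [h, sub_self, mul_zero]
  · exact mul_nonneg (nonneg_of_mul_nonneg_left (hw i) (sub_pos.2 h)) (sub_nonneg.2 (hm h.le))

/-- Subtracting the equations and eliminating `c` makes `lmiForm` at the differences a leakage sum
with weights `d i * b i`. It is nonnegative, so `a = b = 0`; injectivity of the saturation and of
`Rζ` gives the rest. -/
theorem isSteadyState_unique (hd : ∀ i, 0 < d i)
    (h : ∀ a b, (a ≠ 0 ∨ b ≠ 0) → M.lmiForm Pθ d a b < 0) {x y : State N}
    (hx : M.IsSteadyState x) (hy : M.IsSteadyState y) : x = y := by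
  obtain ⟨hx1, hx2, hx3⟩ := hx
  obtain ⟨hy1, hy2, hy3⟩ := hy
  set a := x.1 - y.1 with ha
  set b := M.volt x.2.1 - M.volt y.2.1 with hb
  set c := x.2.2 - y.2.2 with hc
  have e1 : M.Rθ *ᵥ a + M.RθV *ᵥ b = 0 := by
    rw [← sub_self (0 : Fin N → ℝ)]
    nth_rewrite 1 [← hx1]
    rw [← hy1, ha, hb, rhsθ, rhsθ, Matrix.mulVec_sub, Matrix.mulVec_sub]
    abel
  have e2 : M.Rvθ *ᵥ a + (M.RvV - M.β • 1) *ᵥ b + M.Rvζ *ᵥ c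
      = M.ρ x.2.1 * x.2.1 - M.ρ y.2.1 * y.2.1 := by
    have : M.rhsv x - M.rhsv y = 0 := by rw [hx2, hy2, sub_self]
    rw [← sub_eq_zero, ← this, ha, hb, hc, rhsv, rhsv, Matrix.mulVec_sub, Matrix.mulVec_sub,
      Matrix.mulVec_sub]
    abel
  have e3 : M.Rζθ *ᵥ a + M.RζV *ᵥ b + M.Rζ *ᵥ c = 0 := by
    have : M.rhsζ x - M.rhsζ y = 0 := by rw [hx3, hy3, sub_self]
    rw [← this, ha, hb, hc, rhsζ, rhsζ, Matrix.mulVec_sub, Matrix.mulVec_sub, Matrix.mulVec_sub]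
    abel
  rw [eq_neg_inv_of_Rζ e3, reducedRow_eq] at e2
  have hab : ¬(a ≠ 0 ∨ b ≠ 0) := by
    intro hne
    have h1 := h a b hne
    rw [lmiForm, e1, Matrix.mulVec_zero, dotProduct_zero, zero_add, e2] at h1
    refine absurd h1 (not_lt.2 ?_)
    have h2 := sum_leakage_nonneg (M := M) (w := fun i => d i * b i) (v := x.2.1) (v' := y.2.1)
      (fun i => by
        have hm := (M.strictMono_satVolt i).monotone
        have : 0 ≤ b i * (x.2.1 i - y.2.1 i) := by
          change 0 ≤ (M.satVolt i (x.2.1 i) - M.satVolt i (y.2.1 i)) * (x.2.1 i - y.2.1 i)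
          rcases le_total (x.2.1 i) (y.2.1 i) with hle | hle
          · exact mul_nonneg_of_nonpos_of_nonpos (sub_nonpos.2 (hm hle)) (sub_nonpos.2 hle)
          · exact mul_nonneg (sub_nonneg.2 (hm hle)) (sub_nonneg.2 hle)
        rw [mul_assoc]
        exact mul_nonneg (hd i).le this)
    simpa only [Pi.sub_apply, ρ_mul_apply] using h2
  push Not at hab
  have hv : x.2.1 = y.2.1 := funext fun i =>
    (M.strictMono_satVolt i).injective (sub_eq_zero.1 (congrFun hab.2 i))
  have hc0 : c = 0 := by
    rw [eq_neg_inv_of_Rζ e3, hab.1, hab.2]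
    simp
  exact Prod.ext (sub_eq_zero.1 hab.1) (Prod.ext hv (sub_eq_zero.1 hc0))

end Microgrid

namespace Microgrid

variable {N : ℕ} (M : Microgrid N)

/-! ### Error coordinates at a steady state -/

/-- The slow variables `(r_θ, v)`. -/
abbrev SlowState (N : ℕ) : Type := (Fin N → ℝ) × (Fin (N + 1) → ℝ)

/-- Quadratic form in the slow variables with weights `w` for the voltages. -/
def slowForm (Pθ : Matrix (Fin N) (Fin N) ℝ) (w : Fin (N + 1) → ℝ) :
    SlowState N →L[ℝ] SlowState N →L[ℝ] ℝ :=
  LinearMap.toContinuousBilinearMap <| LinearMap.mk₂ ℝ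
    (fun e e' => e.1 ⬝ᵥ (Pθ *ᵥ e'.1) + e.2 ⬝ᵥ (w * e'.2))
    (fun x y z => by simp only [Prod.fst_add, Prod.snd_add, add_dotProduct]; ring)
    (fun c x y => by
      simp only [Prod.smul_fst, Prod.smul_snd, smul_dotProduct, smul_eq_mul]; ring)
    (fun x y z => by
      simp only [Prod.fst_add, Prod.snd_add, dotProduct_add, mul_add, Matrix.mulVec_add]; ring)
    (fun c x y => by
      simp only [Prod.smul_fst, Prod.smul_snd, dotProduct_smul, smul_eq_mul, mul_smul_comm,
        Matrix.mulVec_smul]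
      ring)

theorem slowForm_apply (Pθ : Matrix (Fin N) (Fin N) ℝ) (w : Fin (N + 1) → ℝ) (e e') :
    slowForm Pθ w e e' = e.1 ⬝ᵥ (Pθ *ᵥ e'.1) + e.2 ⬝ᵥ (w * e'.2) := rfl

theorem slowForm_comm {Pθ : Matrix (Fin N) (Fin N) ℝ} (hP : Pθ.PosDef) (w : Fin (N + 1) → ℝ)
    (e e') : slowForm Pθ w e e' = slowForm Pθ w e' e := by
  have hT : Pθᵀ = Pθ := by
    have := hP.isHermitian
    rwa [Matrix.IsHermitian, Matrix.conjTranspose_eq_transpose_of_trivial] at this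
  rw [slowForm_apply, slowForm_apply]
  congr 1
  · rw [dotProduct_comm, ← hT, Matrix.mulVec_transpose, ← Matrix.dotProduct_mulVec, hT]
  · simp only [dotProduct, Pi.mul_apply]
    exact Finset.sum_congr rfl fun i _ => by ring

theorem exists_slowForm_coercive {Pθ : Matrix (Fin N) (Fin N) ℝ} (hP : Pθ.PosDef)
    {w : Fin (N + 1) → ℝ} (hw : ∀ i, 0 < w i) :
    ∃ c > 0, ∀ e, c * ‖e‖ ^ 2 ≤ slowForm Pθ w e e := by
  refine exists_pos_mul_norm_sq_le (q := fun e => slowForm Pθ w e e) (by fun_prop)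
    (fun t x => by simp only [map_smul, _root_.smul_apply, smul_eq_mul]; ring)
    (fun x hx => ?_)
  have h1 : 0 ≤ x.1 ⬝ᵥ (Pθ *ᵥ x.1) := hP.posSemidef.dotProduct_mulVec_nonneg x.1
  have h2 : ∀ i, 0 ≤ x.2 i * (w * x.2) i := fun i => by
    rw [Pi.mul_apply]
    nlinarith [mul_nonneg (hw i).le (sq_nonneg (x.2 i))]
  have h2' : 0 ≤ x.2 ⬝ᵥ (w * x.2) := Finset.sum_nonneg fun i _ => h2 i
  by_cases hx1 : x.1 = 0
  · have hx2 : x.2 ≠ 0 := fun h => hx (Prod.ext hx1 h)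
    obtain ⟨i, hi⟩ := Function.ne_iff.1 hx2
    refine add_pos_of_nonneg_of_pos h1 (Finset.sum_pos' (fun i _ => h2 i) ⟨i, Finset.mem_univ _, ?_⟩)
    have := mul_pos (hw i) (sq_pos_of_ne_zero hi)
    rw [Pi.mul_apply]
    linarith
  · exact add_pos_of_pos_of_nonneg (hP.dotProduct_mulVec_pos hx1) h2'

/-- Quadratic form in the fast variable. -/
def fastForm (N : ℕ) : (Fin N → ℝ) →L[ℝ] (Fin N → ℝ) →L[ℝ] ℝ :=
  LinearMap.toContinuousBilinearMap <| LinearMap.mk₂ ℝ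
    (fun y y' => (relLift N *ᵥ y) ⬝ᵥ (relLift N *ᵥ y'))
    (fun x y z => by simp only [add_dotProduct, Matrix.mulVec_add])
    (fun c x y => by simp only [smul_dotProduct, Matrix.mulVec_smul])
    (fun x y z => by simp only [dotProduct_add, Matrix.mulVec_add])
    (fun c x y => by simp only [dotProduct_smul, Matrix.mulVec_smul])

theorem fastForm_apply (y y' : Fin N → ℝ) :
    fastForm N y y' = (relLift N *ᵥ y) ⬝ᵥ (relLift N *ᵥ y') := rfl

theorem exists_fastForm_coercive (N : ℕ) : ∃ c > 0, ∀ y, c * ‖y‖ ^ 2 ≤ fastForm N y y := by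
  refine exists_pos_mul_norm_sq_le (q := fun e => fastForm N e e) (by fun_prop)
    (fun t x => by simp only [map_smul, _root_.smul_apply, smul_eq_mul]; ring)
    (fun x hx => ?_)
  have h : relLift N *ᵥ x ≠ 0 := fun h => hx (eq_zero_of_relLift_const fun i j => by rw [h]; rfl)
  exact (dotProduct_self_star_pos_iff (v := relLift N *ᵥ x)).2 h

theorem exists_fastForm_Rζ :
    ∃ γ > 0, ∀ y, fastForm N y (M.Rζ *ᵥ y) ≤ -γ * ‖y‖ ^ 2 := by
  obtain ⟨γ, hγ, h⟩ := exists_pos_mul_norm_sq_le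
    (q := fun y => -fastForm N y (M.Rζ.mulVecLin.toContinuousLinearMap y)) (by fun_prop)
    (fun t x => by simp only [map_smul, _root_.smul_apply, smul_eq_mul]; ring)
    (fun x hx => neg_pos.2 (M.relLift_dotProduct_Rζ_neg hx))
  refine ⟨γ, hγ, fun y => ?_⟩
  have := h y
  simp only [LinearMap.coe_toContinuousLinearMap', Matrix.mulVecLin_apply] at this
  linarith

/-- Matrix-vector multiplication as a continuous linear map. -/
def mulVecCLM {m n : Type*} [Fintype m] [Fintype n] (A : Matrix m n ℝ) :
    (n → ℝ) →L[ℝ] (m → ℝ) := A.mulVecLin.toContinuousLinearMap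

theorem mulVecCLM_apply {m n : Type*} [Fintype m] [Fintype n] (A : Matrix m n ℝ) (x : n → ℝ) :
    mulVecCLM A x = A *ᵥ x := rfl

/-- Linearized quasi-steady state of the fast variable; `α` are the slopes of the saturations. -/
def quasiSteady (α : Fin (N + 1) → ℝ) : SlowState N →L[ℝ] (Fin N → ℝ) :=
  -(mulVecCLM M.Rζ⁻¹ ∘L (mulVecCLM M.Rζθ ∘L ContinuousLinearMap.fst ℝ _ _
    + mulVecCLM (M.RζV * Matrix.diagonal α) ∘L ContinuousLinearMap.snd ℝ _ _))

theorem quasiSteady_apply (α : Fin (N + 1) → ℝ) (e : SlowState N) :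
    M.quasiSteady α e = -(M.Rζ⁻¹ *ᵥ (M.Rζθ *ᵥ e.1 + M.RζV *ᵥ (α * e.2))) := by
  have : α * e.2 = Matrix.diagonal α *ᵥ e.2 := by
    ext i
    rw [Matrix.mulVec_diagonal, Pi.mul_apply]
  rw [this, Matrix.mulVec_mulVec]
  rfl

/-- Coupling of the fast variable into the slow equations. -/
def fastCoupling : (Fin N → ℝ) →L[ℝ] SlowState N :=
  (0 : (Fin N → ℝ) →L[ℝ] (Fin N → ℝ)).prod (M.τv⁻¹ • mulVecCLM M.Rvζ)

theorem fastCoupling_apply (y : Fin N → ℝ) : M.fastCoupling y = (0, M.τv⁻¹ • (M.Rvζ *ᵥ y)) := rfl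

/-- Influence of a voltage error on the slow equations. -/
def voltCoupling : (Fin (N + 1) → ℝ) →L[ℝ] SlowState N :=
  (mulVecCLM M.RθV).prod (M.τv⁻¹ • mulVecCLM (M.RvV - M.β • 1))

theorem voltCoupling_apply (r : Fin (N + 1) → ℝ) :
    M.voltCoupling r = (M.RθV *ᵥ r, M.τv⁻¹ • ((M.RvV - M.β • 1) *ᵥ r)) := rfl

/-- State with slow error `e` and fast variable at its linearized quasi-steady state. -/
def slowLift (α : Fin (N + 1) → ℝ) (xbar : State N) (e : SlowState N) : State N :=
  xbar + (e.1, e.2, M.quasiSteady α e)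

/-- Slow vector field in the error coordinates. -/
def slowField (α : Fin (N + 1) → ℝ) (xbar : State N) (e : SlowState N) : SlowState N :=
  (M.rhsθ (M.slowLift α xbar e), M.τv⁻¹ • M.rhsv (M.slowLift α xbar e))

/-- Slopes of the saturations at `xbar`. -/
def slopes (xbar : State N) : Fin (N + 1) → ℝ := fun i => M.satSlope i (xbar.2.1 i)

/-- Second-order remainder of the saturations at `xbar`. -/
def voltRemainder (xbar : State N) (e : SlowState N) : Fin (N + 1) → ℝ :=
  M.volt (xbar.2.1 + e.2) - M.volt xbar.2.1 - M.slopes xbar * e.2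

theorem eventually_norm_voltRemainder_le (xbar : State N) {η : ℝ} (hη : 0 < η) :
    ∀ᶠ e in nhds 0, ‖M.voltRemainder xbar e‖ ≤ η * ‖e‖ := by
  have h : ∀ i, ∀ᶠ e : SlowState N in nhds 0, ‖M.voltRemainder xbar e i‖ ≤ η * ‖e‖ := by
    intro i
    have h1 := (hasDerivAt_iff_isLittleO_nhds_zero.1
      (M.hasDerivAt_satVolt i (xbar.2.1 i))).bound hη
    have ht : Filter.Tendsto (fun e : SlowState N => e.2 i) (nhds 0) (nhds 0) := by
      have : Continuous fun e : SlowState N => e.2 i := by fun_prop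
      exact this.tendsto 0
    filter_upwards [ht.eventually h1] with e he
    have h2 : M.voltRemainder xbar e i = M.satVolt i (xbar.2.1 i + e.2 i)
        - M.satVolt i (xbar.2.1 i) - e.2 i • M.satSlope i (xbar.2.1 i) := by
      rw [smul_eq_mul, mul_comm]
      rfl
    rw [h2]
    refine he.trans (mul_le_mul_of_nonneg_left ?_ hη.le)
    exact (norm_le_pi_norm e.2 i).trans (norm_snd_le e)
  filter_upwards [Filter.eventually_all.2 h] with e he
  exact (pi_norm_le_iff_of_nonneg (by positivity)).2 he

variable {M}

theorem volt_slowLift (xbar : State N) (α) (e : SlowState N) :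
    M.volt (M.slowLift α xbar e).2.1
      = M.volt xbar.2.1 + (M.slopes xbar * e.2 + M.voltRemainder xbar e) := by
  have : (M.slowLift α xbar e).2.1 = xbar.2.1 + e.2 := rfl
  rw [this, voltRemainder]
  abel

/-- The steady-state equations are subtracted and the voltage error is split into its linear part
and a remainder. The leakage difference stays exact, since the leakage has a kink at `|v i| = 3 * Δ
i`. -/
theorem slowField_eq {xbar : State N} (h : M.IsSteadyState xbar) (e : SlowState N) :
    M.slowField (M.slopes xbar) xbar e
      = (M.Rθ *ᵥ e.1 + M.RθV *ᵥ (M.slopes xbar * e.2),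
          M.τv⁻¹ • (M.reducedRow e.1 (M.slopes xbar * e.2)
            - (M.ρ (xbar.2.1 + e.2) * (xbar.2.1 + e.2) - M.ρ xbar.2.1 * xbar.2.1)))
        + M.voltCoupling (M.voltRemainder xbar e) := by
  obtain ⟨h1, h2, -⟩ := h
  rw [slowField, voltCoupling_apply]
  refine Prod.ext ?_ ?_
  · change M.rhsθ _ = _ + _
    rw [← sub_zero (M.rhsθ _), ← h1, rhsθ, rhsθ, volt_slowLift]
    have : (M.slowLift (M.slopes xbar) xbar e).1 = xbar.1 + e.1 := rfl
    rw [this]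
    simp only [Matrix.mulVec_add]
    abel
  · change M.τv⁻¹ • M.rhsv _ = _ + _
    simp only
    rw [← smul_add]
    congr 1
    rw [← sub_zero (M.rhsv _), ← h2, ← reducedRow_eq, ← quasiSteady_apply, rhsv, rhsv,
      volt_slowLift]
    have e1 : (M.slowLift (M.slopes xbar) xbar e).1 = xbar.1 + e.1 := rfl
    have e2 : (M.slowLift (M.slopes xbar) xbar e).2.1 = xbar.2.1 + e.2 := rfl
    have e3 : (M.slowLift (M.slopes xbar) xbar e).2.2
        = xbar.2.2 + M.quasiSteady (M.slopes xbar) e := rfl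
    rw [e1, e2, e3]
    simp only [Matrix.mulVec_add]
    abel

/-- The linearized quasi-steady value cancels all linear terms, so only the remainder of the
saturation drives the fast error. -/
theorem rhsζ_slowLift {xbar : State N} (h : M.IsSteadyState xbar) (e : SlowState N) :
    M.rhsζ (M.slowLift (M.slopes xbar) xbar e) = M.RζV *ᵥ M.voltRemainder xbar e := by
  have h3 := h.2.2
  have hq : M.Rζ *ᵥ M.quasiSteady (M.slopes xbar) e
      = -(M.Rζθ *ᵥ e.1 + M.RζV *ᵥ (M.slopes xbar * e.2)) := by
    rw [quasiSteady_apply, Matrix.mulVec_neg, inv_Rζ_mulVec]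
  rw [← sub_zero (M.rhsζ _), ← h3, rhsζ, rhsζ, volt_slowLift]
  have e1 : (M.slowLift (M.slopes xbar) xbar e).1 = xbar.1 + e.1 := rfl
  have e3 : (M.slowLift (M.slopes xbar) xbar e).2.2
      = xbar.2.2 + M.quasiSteady (M.slopes xbar) e := rfl
  rw [e1, e3]
  simp only [Matrix.mulVec_add, hq]
  abel

/-- Weights of the voltage errors in the Lyapunov function. -/
def voltWeights (M : Microgrid N) (d : Fin (N + 1) → ℝ) (xbar : State N) : Fin (N + 1) → ℝ :=
  fun i => M.τv * (d i * M.slopes xbar i)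

/-- In the weights, `τv` cancels the time constant, and `d i` times the slope pairs the row with `d
i * b i` for `b` the linearized voltage error, exactly as in `lmiForm`. The leakage is dropped by
monotonicity. -/
theorem slowForm_slowField_le {xbar : State N} (h : M.IsSteadyState xbar)
    {Pθ : Matrix (Fin N) (Fin N) ℝ} {d : Fin (N + 1) → ℝ} (hd : ∀ i, 0 < d i) (e : SlowState N) :
    slowForm Pθ (M.voltWeights d xbar) e (M.slowField (M.slopes xbar) xbar e)
      ≤ M.lmiForm Pθ d e.1 (M.slopes xbar * e.2)
        + slowForm Pθ (M.voltWeights d xbar) e (M.voltCoupling (M.voltRemainder xbar e)) := by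
  rw [slowField_eq h, map_add]
  refine add_le_add ?_ le_rfl
  rw [slowForm_apply, lmiForm]
  refine add_le_add le_rfl ?_
  have hleak := sum_leakage_nonneg (M := M) (w := fun i => d i * M.slopes xbar i * e.2 i)
    (v := xbar.2.1 + e.2) (v' := xbar.2.1) fun i => by
      have h0 : 0 < d i * M.slopes xbar i := mul_pos (hd i) (M.satSlope_pos i _)
      rw [Pi.add_apply, add_sub_cancel_left, mul_assoc]
      exact mul_nonneg h0.le (mul_self_nonneg _)
  have hτ := M.τv_pos.ne'
  have e1 : e.2 ⬝ᵥ (M.voltWeights d xbar * M.τv⁻¹ • (M.reducedRow e.1 (M.slopes xbar * e.2)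
      - (M.ρ (xbar.2.1 + e.2) * (xbar.2.1 + e.2) - M.ρ xbar.2.1 * xbar.2.1)))
      = ∑ i, d i * (M.slopes xbar * e.2) i * M.reducedRow e.1 (M.slopes xbar * e.2) i
        - ∑ i, d i * M.slopes xbar i * e.2 i
          * (M.leakage i ((xbar.2.1 + e.2) i) - M.leakage i (xbar.2.1 i)) := by
    rw [← Finset.sum_sub_distrib]
    refine Finset.sum_congr rfl fun i _ => ?_
    rw [Pi.mul_apply, Pi.smul_apply, Pi.sub_apply, Pi.sub_apply, ρ_mul_apply, ρ_mul_apply,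
      voltWeights, Pi.mul_apply, smul_eq_mul]
    field_simp
  rw [e1]
  linarith

theorem exists_lmiForm_le {Pθ : Matrix (Fin N) (Fin N) ℝ} {d : Fin (N + 1) → ℝ}
    (h : ∀ a b, (a ≠ 0 ∨ b ≠ 0) → M.lmiForm Pθ d a b < 0) {α : Fin (N + 1) → ℝ}
    (hα : ∀ i, 0 < α i) :
    ∃ c > 0, ∀ e : SlowState N, M.lmiForm Pθ d e.1 (α * e.2) ≤ -c * ‖e‖ ^ 2 := by
  obtain ⟨c, hc, hle⟩ := exists_pos_mul_norm_sq_le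
    (q := fun e : SlowState N => -M.lmiForm Pθ d e.1 (α * e.2))
    (by unfold lmiForm reducedRow; fun_prop)
    (fun t x => by
      have hr : ∀ i, M.reducedRow (t • x.1) (α * t • x.2) i
          = t * M.reducedRow x.1 (α * x.2) i := fun i => by
        simp only [reducedRow, mul_smul_comm, Matrix.mulVec_smul, ← smul_add, Pi.smul_apply,
          smul_eq_mul]
      simp only [lmiForm, Prod.smul_fst, Prod.smul_snd, hr]
      simp only [mul_smul_comm, Matrix.mulVec_smul, ← smul_add, smul_dotProduct,
        dotProduct_smul, Pi.smul_apply, smul_eq_mul, mul_neg, mul_add, Finset.mul_sum, neg_add]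
      congr 1
      · ring
      · exact congrArg _ (Finset.sum_congr rfl fun i _ => by ring))
    (fun x hx => by
      refine neg_pos.2 (h _ _ ?_)
      by_contra hcon
      push Not at hcon
      refine hx (Prod.ext hcon.1 (funext fun i => ?_))
      have := congrFun hcon.2 i
      exact (mul_eq_zero.1 this).resolve_left (hα i).ne')
  exact ⟨c, hc, fun e => by linarith [hle e]⟩

/-! ### Exponential stability for small time-scale ratios -/

theorem exists_exponentiallyStable {xbar : State N} (h : M.IsSteadyState xbar)
    {Pθ : Matrix (Fin N) (Fin N) ℝ} {d : Fin (N + 1) → ℝ} (hP : Pθ.PosDef) (hd : ∀ i, 0 < d i)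
    (hform : ∀ a b, (a ≠ 0 ∨ b ≠ 0) → M.lmiForm Pθ d a b < 0) :
    ∃ εstar > 0, ∀ ε, 0 < ε → ε < εstar → ExponentiallyStable (M.ratioField ε) xbar := by
  set α := M.slopes xbar with hα
  have hαpos : ∀ i, 0 < α i := fun i => M.satSlope_pos i _
  set P := slowForm Pθ (M.voltWeights d xbar) with hPdef
  obtain ⟨cP, hcP, hPc⟩ := exists_slowForm_coercive hP (w := M.voltWeights d xbar)
    fun i => mul_pos M.τv_pos (mul_pos (hd i) (hαpos i))
  obtain ⟨cQ, hcQ, hQc⟩ := exists_fastForm_coercive N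
  obtain ⟨γ, hγ, hR⟩ := M.exists_fastForm_Rζ
  obtain ⟨a, ha, hA⟩ := exists_lmiForm_le hform hαpos
  set H := M.quasiSteady α with hH
  set S : State N →L[ℝ] SlowState N := (ContinuousLinearMap.fst ℝ _ _).prod
    (ContinuousLinearMap.fst ℝ _ _ ∘L ContinuousLinearMap.snd ℝ _ _)
  have hS : ∀ x, S x = (x.1, x.2.1) := fun x => rfl
  set Y : State N →L[ℝ] (Fin N → ℝ) :=
    ContinuousLinearMap.snd ℝ _ _ ∘L ContinuousLinearMap.snd ℝ _ _ - H ∘L S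
  have hY : ∀ x, Y x = x.2.2 - H (S x) := fun x => rfl
  obtain ⟨cE, hcE, hSY⟩ := exists_pos_mul_norm_sq_le
    (q := fun x : State N => ‖S x‖ ^ 2 + ‖Y x‖ ^ 2) (by fun_prop)
    (fun t x => by
      simp only [map_smul, norm_smul, mul_pow, Real.norm_eq_abs, sq_abs]
      ring)
    (fun x hx => by
      by_contra hcon
      have h1 : ‖S x‖ ^ 2 + ‖Y x‖ ^ 2 = 0 := le_antisymm (not_lt.1 hcon) (by positivity)
      have h2 : S x = 0 := by
        have : ‖S x‖ ^ 2 = 0 := by nlinarith [sq_nonneg ‖S x‖, sq_nonneg ‖Y x‖]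
        simpa using this
      have h3 : Y x = 0 := by
        have : ‖Y x‖ ^ 2 = 0 := by nlinarith [sq_nonneg ‖S x‖, sq_nonneg ‖Y x‖]
        simpa using this
      rw [hY, h2, map_zero, sub_zero] at h3
      rw [hS] at h2
      have h4 : x.1 = 0 := (Prod.ext_iff.1 h2).1
      have h5 : x.2.1 = 0 := (Prod.ext_iff.1 h2).2
      exact hx (Prod.ext h4 (Prod.ext h5 h3)))
  have hlift0 : M.slowLift α xbar 0 = xbar := by
    rw [slowLift, map_zero]
    exact add_zero _
  have hlift : ContDiff ℝ 1 (M.slowLift α xbar) :=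
    contDiff_const.add (contDiff_fst.prodMk (contDiff_snd.prodMk (M.quasiSteady α).contDiff))
  have hf0 : M.slowField α xbar 0 = 0 := by
    rw [slowField, hlift0, h.1, h.2.1, smul_zero]
    rfl
  have hfl : LocallyLipschitz (M.slowField α xbar) :=
    (M.contDiff_rhsθ.locallyLipschitz.comp hlift.locallyLipschitz).prodMk
      ((lipschitzWith_smul M.τv⁻¹).locallyLipschitz.comp
        (M.locallyLipschitz_rhsv.comp hlift.locallyLipschitz))
  obtain ⟨C, hC⟩ := hfl.exists_eventually_norm_le hf0
  have hdecomp : ∀ x : State N, x.1 = (M.slowLift α xbar (S (x - xbar))).1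
      ∧ x.2.1 = (M.slowLift α xbar (S (x - xbar))).2.1
      ∧ x.2.2 = (M.slowLift α xbar (S (x - xbar))).2.2 + Y (x - xbar) := by
    intro x
    refine ⟨(add_sub_cancel xbar.1 x.1).symm, (add_sub_cancel xbar.2.1 x.2.1).symm, ?_⟩
    change x.2.2 = xbar.2.2 + H (S (x - xbar)) + (x.2.2 - xbar.2.2 - H (S (x - xbar)))
    abel
  have hFS : ∀ ε x, S (M.ratioField ε x)
      = M.slowField α xbar (S (x - xbar)) + M.fastCoupling (Y (x - xbar)) := by
    intro ε x
    obtain ⟨h1, h2, h3⟩ := hdecomp x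
    rw [hS, fastCoupling_apply, slowField]
    refine Prod.ext ?_ ?_
    · change M.rhsθ x = M.rhsθ _ + 0
      rw [add_zero, rhsθ, rhsθ, ← h1, ← h2]
    · change M.τv⁻¹ • M.rhsv x = M.τv⁻¹ • M.rhsv _ + _
      rw [← smul_add, rhsv, rhsv, ← h1, ← h2, h3, Matrix.mulVec_add]
      congr 1
      abel
  refine exists_exponentiallyStable_of_singular_perturbation (S := S) (Y := Y)
    (f₀ := M.slowField α xbar) (g := fun e => M.rhsζ (M.slowLift α xbar e)) (B := M.fastCoupling)
    (H := H) (R := mulVecCLM M.Rζ) (P := P) (Q := fastForm N)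
    (slowForm_comm hP _) (fun x y => by rw [fastForm_apply, fastForm_apply, dotProduct_comm])
    hcE hcP hcQ (half_pos ha) hγ hSY hPc hQc ?_ hC ?_ hR M.locallyLipschitz_ratioField hFS ?_
  -- The saturation remainder may use up half of the decay `a` given by the matrix inequality, which
  -- leaves the rate `a / 2`.
  · have hη : 0 < a / 2 / (‖P‖ * ‖M.voltCoupling‖ + 1) := by positivity
    filter_upwards [M.eventually_norm_voltRemainder_le xbar hη] with e he
    have h1 := slowForm_slowField_le h (Pθ := Pθ) hd e
    have h2 := (le_abs_self _).trans (abs_apply_apply_le P e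
      ((M.voltCoupling.le_opNorm (M.voltRemainder xbar e)).trans
        (mul_le_mul_of_nonneg_left he (norm_nonneg _))))
    have h3 : ‖P‖ * ‖e‖ * (‖M.voltCoupling‖ * (a / 2 / (‖P‖ * ‖M.voltCoupling‖ + 1) * ‖e‖))
        ≤ a / 2 * ‖e‖ ^ 2 := by
      calc _ = ‖P‖ * ‖M.voltCoupling‖ * (a / 2 / (‖P‖ * ‖M.voltCoupling‖ + 1) * ‖e‖ ^ 2) := by ring
        _ ≤ (‖P‖ * ‖M.voltCoupling‖ + 1)
            * (a / 2 / (‖P‖ * ‖M.voltCoupling‖ + 1) * ‖e‖ ^ 2) := by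
          gcongr
          linarith
        _ = _ := by field_simp
    have h4 := hA e
    linarith
  · intro η hη
    have hη' : 0 < η / (‖mulVecCLM M.RζV‖ + 1) := by positivity
    filter_upwards [M.eventually_norm_voltRemainder_le xbar hη'] with e he
    rw [hα, rhsζ_slowLift h]
    calc _ ≤ ‖mulVecCLM M.RζV‖ * ‖M.voltRemainder xbar e‖ := (mulVecCLM M.RζV).le_opNorm _
      _ ≤ (‖mulVecCLM M.RζV‖ + 1) * (η / (‖mulVecCLM M.RζV‖ + 1) * ‖e‖) := by
        gcongr
        linarith
      _ = _ := by field_simp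
  · intro ε x
    obtain ⟨h1, h2, h3⟩ := hdecomp x
    rw [hY, hFS]
    congr 1
    change ε⁻¹ • M.rhsζ x = _
    rw [mulVecCLM_apply, rhsζ, rhsζ, ← h1, ← h2, h3, Matrix.mulVec_add]
    congr 1
    abel

end Microgrid

end

theorem theorem1 {N : ℕ} (M : Microgrid N) (hLMI : M.LMIFeasible) :
    ∃ xbar : Microgrid.State N,
      (M.IsSteadyState xbar ∧ ∀ x, M.IsSteadyState x → x = xbar) ∧
      ∃ εstar : ℝ, 0 < εstar ∧ ∀ τd : ℝ, 0 < τd → τd < εstar * M.τv →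
        ExponentiallyStable (M.field τd) xbar := by
  obtain ⟨Pθ, d, hP, hd, hform⟩ := hLMI.exists_lmiForm_neg
  obtain ⟨xbar, hx⟩ := Microgrid.exists_isSteadyState hd hform
  obtain ⟨εstar, hε, hstab⟩ := Microgrid.exists_exponentiallyStable hx hP hd hform
  refine ⟨xbar, ⟨hx, fun x hx' => Microgrid.isSteadyState_unique hd hform hx' hx⟩, εstar, hε,
    fun τd hτ hτε => ?_⟩
  exact hstab (τd / M.τv) (div_pos hτ M.τv_pos) ((div_lt_iff₀ M.τv_pos).2 hτε)
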